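/- Let $n\ge 2$, let $S=\{z\in\mathbb C^n : |z|=1\}$ with normalized surface measure $\sigma$, let $(z\mid w)=\sum_j z_j\overline{w_j}$, and let $\eta\in S$. For $p,q\ge 0$ let $H^{(p,q)}$ be the space of restrictions to $S$ of the polynomials $P(z,\bar z)$ on $\mathbb C^n$ that satisfy $P(\lambda z,\bar\lambda\bar z)=\lambda^p\bar\lambda^q P(z,\bar z)$ for all $\lambda\in\mathbb C$, $z\in\mathbb C^n$, and $\Delta P=0$, where $\Delta=4\sum_j\partial^2/\partial z_j\partial\bar z_j$. Let $Z^{(p,q)}_\eta$ be the zonal harmonic of bidegree $(p,q)$ with pole $\eta$ and value $1$ at $\eta$, i.e. $Z^{(p,q)}_\eta(\xi)=W_{p,q}((\xi\mid\eta))$ with $$W_{p,q}(w)=\frac{(n-1)_{p+q}}{(n-1)_p\,(n-1)_q}\sum_{i=0}^{\min(p,q)}\frac{(-p)_i(-q)_i}{(2-n-p-q)_i\, i!}\,w^{p-i}\,\bar w^{\,q-i},$$ where $(r)_i=r(r+1)\cdots(r+i-1)$. Let $f:S\to\mathbb C$ be a zonal function with pole $\eta$ (that is, invariant under the isotropy group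 of $\eta$ in $SU(n)$) with profile $\varphi$: $f(\xi)=\varphi((\xi\mid\eta))$ for $\xi\in S$. Assume that $\varphi$ is continuous on the closed unit disc and real analytic in the open disc, and that its Taylor series around $0$, $$\sum_{j,k=0}^\infty\frac{\partial^j\bar\partial^k\varphi(0)}{j!\,k!}\,w^j\bar w^k ,\qquad \partial=\tfrac{\partial}{\partial w},\quad \bar\partial=\tfrac{\partial}{\partial\bar w},$$ converges absolutely on the unit circle. Then for all $p,q\ge0$ the series $$d_{p,q}=(n-1)!\sum_{k=0}^\infty\frac{\partial^{p+k}\bar\partial^{q+k}\varphi(0)}{k!\,(n-1+p+q+k)!}$$ converges absolutely, and $c=d_{p,q}$ is the unique number for which $c\,\dim H^{(p,q)}\,Z^{(p,q)}_\eta$ is the component (the orthogonal projection in $L^2(S,\sigma)$) of $f$ in $H^{(p,q)}$. Moreover the resulting spherical harmonic expansion $$f(\xi)=\sum_{p,q=0}^\infty d_{p,q}\,\dim H^{(p,q)}\,Z^{(p,q)}_\eta(\xi)$$ converges to $f$ absolutely and uniformly on $S$. -/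

import Mathlib

open scoped ComplexConjugate

noncomputable section

namespace ComplexSphere

/-! ### The unit sphere of `ℂⁿ` -/

/-- The unit sphere `S = {z ∈ ℂⁿ : |z| = 1}`. -/
abbrev Sph (n : ℕ) : Type := Metric.sphere (0 : EuclideanSpace ℂ (Fin n)) 1

/-- The Hermitian product `(z | w) = ∑ⱼ zⱼ w̄ⱼ`, linear in the first variable. -/
def herm {n : ℕ} (z w : EuclideanSpace ℂ (Fin n)) : ℂ := ∑ j, z j * conj (w j)

/-- The Euclidean surface measure on `S`, normalized to total mass one. -/
def sigma (n : ℕ) : MeasureTheory.Measure (Sph n) :=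
  ((MeasureTheory.volume : MeasureTheory.Measure (EuclideanSpace ℂ (Fin n))).toSphere Set.univ)⁻¹ •
    (MeasureTheory.volume : MeasureTheory.Measure (EuclideanSpace ℂ (Fin n))).toSphere

/-- `f` is zonal with pole `η`: it is invariant under the isotropy group of `η` in `SU(n)`. -/
def IsZonal {n : ℕ} (η : Sph n) (f : Sph n → ℂ) : Prop :=
  ∀ U ∈ Matrix.specialUnitaryGroup (Fin n) ℂ, U.mulVec (η.1 : Fin n → ℂ) = (η.1 : Fin n → ℂ) →
    ∀ ξ ξ' : Sph n, (ξ'.1 : Fin n → ℂ) = U.mulVec (ξ.1 : Fin n → ℂ) → f ξ' = f ξ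

/-- `φ` is a profile of `f` with respect to `η`: `f ξ = φ ((ξ | η))` on the sphere.  Only the values
of `φ` on the closed unit disc matter. -/
def IsProfile {n : ℕ} (η : Sph n) (f : Sph n → ℂ) (φ : ℂ → ℂ) : Prop :=
  ∀ ξ : Sph n, f ξ = φ (herm ξ.1 η.1)

/-! ### Complex spherical harmonics -/

/-- Polynomials `P(z, z̄)` on `ℂⁿ ≅ ℝ²ⁿ`, written in the variables `zⱼ` (`Sum.inl j`) and
`z̄ⱼ` (`Sum.inr j`). -/
abbrev Poly (n : ℕ) : Type := MvPolynomial (Fin n ⊕ Fin n) ℂ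

/-- The value `P(z, z̄)` of a polynomial at a point `z` of `ℂⁿ`. -/
def evalAt {n : ℕ} (z : EuclideanSpace ℂ (Fin n)) (P : Poly n) : ℂ :=
  MvPolynomial.eval (Sum.elim (fun j => z j) (fun j => conj (z j))) P

/-- The Euclidean Laplacian of `ℝ²ⁿ` in complex coordinates, `Δ = 4 ∑ⱼ ∂² / ∂zⱼ ∂z̄ⱼ`. -/
def laplacian (n : ℕ) : Poly n →ₗ[ℂ] Poly n :=
  (4 : ℂ) • ∑ j : Fin n,
    (MvPolynomial.pderiv (R := ℂ) (Sum.inl j : Fin n ⊕ Fin n)).toLinearMap ∘ₗ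
      (MvPolynomial.pderiv (R := ℂ) (Sum.inr j : Fin n ⊕ Fin n)).toLinearMap

/-- The space of bihomogeneous polynomials of degree `(p, q)`:
`P(λz, λ̄z̄) = λᵖ λ̄^q P(z, z̄)` for all `λ ∈ ℂ` and `z ∈ ℂⁿ`. -/
def bihomogeneous (n p q : ℕ) : Submodule ℂ (Poly n) where
  carrier := {P | ∀ (l : ℂ) (z : EuclideanSpace ℂ (Fin n)),
    evalAt (l • z) P = l ^ p * conj l ^ q * evalAt z P}
  add_mem' := by
    intro P Q hP hQ l z
    have h1 := hP l z
    have h2 := hQ l z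
    simp only [evalAt, map_add] at *
    rw [h1, h2]; ring
  zero_mem' := by
    intro l z
    simp [evalAt]
  smul_mem' := by
    intro c P hP l z
    have h1 := hP l z
    simp only [evalAt, MvPolynomial.smul_eval] at *
    rw [h1]; ring

/-- Solid harmonics: harmonic bihomogeneous polynomials of bidegree `(p, q)`. -/
def solidHarmonics (n p q : ℕ) : Submodule ℂ (Poly n) :=
  bihomogeneous n p q ⊓ LinearMap.ker (laplacian n)

/-- Restriction of polynomials to the sphere. -/
def restrictToSphere (n : ℕ) : Poly n →ₗ[ℂ] (Sph n → ℂ) where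
  toFun P := fun ξ => evalAt ξ.1 P
  map_add' P Q := by ext ξ; simp [evalAt]
  map_smul' c P := by ext ξ; simp [evalAt, MvPolynomial.smul_eval]

/-- Surface harmonics: the space `H^(p,q)` of restrictions to `S` of the solid harmonics. -/
def surfaceHarmonics (n p q : ℕ) : Submodule ℂ (Sph n → ℂ) :=
  (solidHarmonics n p q).map (restrictToSphere n)

/-- The dimension of `H^(p,q)`. -/
def dimH (n p q : ℕ) : ℕ := Module.finrank ℂ (surfaceHarmonics n p q)

/-- `g` is the component of `f ∈ L²(S, dσ)` in `H^(p,q)`, that is, the orthogonal projection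
of `f` onto `H^(p,q)` with respect to the inner product `∫ f h̄ dσ`. -/
def IsHarmonicComponent (n p q : ℕ) (f g : Sph n → ℂ) : Prop :=
  MeasureTheory.MemLp f 2 (sigma n) ∧ g ∈ surfaceHarmonics n p q ∧
    ∀ h ∈ surfaceHarmonics n p q, ∫ ξ, (f ξ - g ξ) * conj (h ξ) ∂(sigma n) = 0

/-! ### Disc polynomials and zonal harmonics -/

/-- The Pochhammer symbol `(r)ᵢ = r (r + 1) ⋯ (r + i - 1)`. -/
def poch (r : ℂ) (i : ℕ) : ℂ := (ascPochhammer ℂ i).eval r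

/-- The disc polynomial of bidegree `(p, q)` with parameter `α`,
`(α+1)_{p+q} / ((α+1)_p (α+1)_q) · wᵖ w̄^q · ₂F₁(-p, -q; -α-p-q; 1/|w|²)`.
The hypergeometric series stops at `i = min p q`, and `wᵖ w̄^q |w|^(-2i) = w^(p-i) w̄^(q-i)`, so that
the expression is a polynomial in `w` and `w̄` (and is meant as such at `w = 0`). -/
def discPoly (α p q : ℕ) (w : ℂ) : ℂ :=
  poch (α + 1) (p + q) / (poch (α + 1) p * poch (α + 1) q) *
    ∑ i ∈ Finset.range (min p q + 1),
      poch (-p) i * poch (-q) i / (poch (-α - p - q) i * (i.factorial : ℂ)) *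
        (w ^ (p - i) * conj w ^ (q - i))

/-- The zonal harmonic `Z^(p,q)_η` on the sphere of `ℂⁿ`, `n ≥ 2`, normalized to have
the value `1` at the pole `η`. -/
def zonalHarmonic {n : ℕ} (η : Sph n) (p q : ℕ) (ξ : Sph n) : ℂ :=
  discPoly (n - 2) p q (herm ξ.1 η.1)

/-! ### Wirtinger derivatives and the expansion coefficients -/

/-- `∂φ = ½ (∂φ/∂x - i ∂φ/∂y)`. -/
def dW (φ : ℂ → ℂ) (w : ℂ) : ℂ :=
  (fderiv ℝ φ w 1 - Complex.I * fderiv ℝ φ w Complex.I) / 2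

/-- `∂̄φ = ½ (∂φ/∂x + i ∂φ/∂y)`. -/
def dWbar (φ : ℂ → ℂ) (w : ℂ) : ℂ :=
  (fderiv ℝ φ w 1 + Complex.I * fderiv ℝ φ w Complex.I) / 2

/-- The number `∂ʲ ∂̄ᵏ φ (0)`. -/
def taylorDeriv (φ : ℂ → ℂ) (j k : ℕ) : ℂ := (dW^[j] (dWbar^[k] φ)) 0

/-- The terms of the series for the coefficients,
`∂^(p+k) ∂̄^(q+k) φ (0) / (k! (n - 1 + p + q + k)!)`. -/
def coeffTerm (n : ℕ) (φ : ℂ → ℂ) (p q k : ℕ) : ℂ :=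
  taylorDeriv φ (p + k) (q + k) /
    ((k.factorial : ℂ) * ((n - 1 + p + q + k).factorial : ℂ))

/-- `d_{p,q}(φ) = (n - 1)! ∑ₖ ∂^(p+k) ∂̄^(q+k) φ (0) / (k! (n - 1 + p + q + k)!)`. -/
def expansionCoeff (n : ℕ) (φ : ℂ → ℂ) (p q : ℕ) : ℂ :=
  ((n - 1).factorial : ℂ) * ∑' k : ℕ, coeffTerm n φ p q k

/-- The `(p, q)` term `c · dim H^(p,q) · Z^(p,q)_η` of a zonal expansion. -/
def zonalTerm {n : ℕ} (η : Sph n) (c : ℂ) (p q : ℕ) (ξ : Sph n) : ℂ :=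
  c * (dimH n p q : ℂ) * zonalHarmonic η p q ξ

end ComplexSphere

end

noncomputable section

namespace ComplexSphere

section

open MeasureTheory

/-! ### Gaussian and spherical integrals of polynomials -/

/-! Everything rests on a Funk–Hecke formula for the zonal monomials `ζʲ ζ̄ᵏ`, `ζ = (ξ | η)`:
pairing one of them with any `h ∈ H^(p,q)` gives an explicit constant times `h η`, and the constant
vanishes unless `j - p = k - q ≥ 0` (`integral_mul_conj_zonalMonomial`). By homogeneity and polar
coordinates the sphere integral is a Gaussian expectation up to a quotient of Gamma values. There
integration by parts turns multiplication by `ζ` and `ζ̄` into the derivatives `derivR` and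
`derivL`, which preserve harmonicity and lower the bidegree by one. Euler's identity evaluates them
at the pole, and harmonic polynomials of nonzero bidegree have mean zero (`IsSolid.gaussExp_mul`).

Only the leading monomial of the disc polynomial pairs nontrivially with `H^(p,q)`, so `Z^(p,q)_η`
is a multiple of the reproducing kernel. An orthonormal basis identifies the constant as `1 / dim
H^(p,q)` (`zonalNormSq_mul_dimH`), and `|Z| ≤ 1` follows. Disc polynomials are triangular in the
monomials, so each `ζʲ ζ̄ᵏ` is a finite combination of the `Z^(j-i,k-i)`, with coefficients
`spherePairing * dimH` read off by orthogonality (`zonalMonomial_eq_sum`). These coefficients are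
nonnegative and, by evaluation at the pole, sum to `1` (`sum_norm_spherePairing`).

Hence inserting these expansions into the Taylor series of `φ` gives a triple series dominated,
uniformly in `ξ`, by a series with sum `∑ |a_jk|`, where `a_jk` are the Taylor coefficients
(`summable_majorant`). Summed over `i` at fixed `(j, k)` it yields `f`; summed along the diagonals
`(p + i, q + i)` it yields the spherical harmonic expansion with coefficients `d_{p,q}`. That `φ`
equals its Taylor series on the closed disc follows from the one-variable identity theorem on rays
and continuity up to the circle (`hasSum_taylorCoeff`). -/

/-- The moment `π⁻¹ ∫ zᵃ z̄ᵇ exp(-|z|²)` of the standard complex Gaussian. -/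
def gaussMoment (a b : ℕ) : ℂ := if a = b then (a.factorial : ℂ) else 0

/-- Integration by parts in one complex variable: multiplication by `z` is traded for `∂/∂z̄`. At `b
= 0` the truncated exponent is harmless because its factor is zero. -/
lemma gaussMoment_succ_left (a b : ℕ) : gaussMoment (a + 1) b = b * gaussMoment a (b - 1) := by
  rcases b with _ | b
  · simp [gaussMoment]
  · by_cases h : a = b
    · subst h; simp [gaussMoment, Nat.factorial_succ]
    · simp [gaussMoment, h]

lemma gaussMoment_comm (a b : ℕ) : gaussMoment a b = gaussMoment b a := by
  by_cases h : a = b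
  · rw [h]
  · simp [gaussMoment, h, Ne.symm h]

lemma integrable_norm_pow_mul_exp (N : ℕ) :
    Integrable (fun z : ℂ => ‖z‖ ^ N * Real.exp (-‖z‖ ^ 2)) := by
  have h := Complex.integral_rpow_mul_exp_neg_rpow (p := 2) (q := N) (by norm_num)
    (by have : (0 : ℝ) ≤ N := N.cast_nonneg
        linarith)
  norm_cast at h
  -- A non-integrable function has integral `0` by convention, while the known value is positive.
  by_contra hc
  rw [integral_undef hc] at h
  have : 0 < Real.Gamma (((N + 2 : ℕ) : ℝ) / 2) := Real.Gamma_pos_of_pos (by positivity)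
  have hpi := Real.pi_pos
  have h2 : 0 < 2 * Real.pi / ((2 : ℕ) : ℝ) * Real.Gamma (((N + 2 : ℕ) : ℝ) / 2) := by positivity
  exact absurd h (by simpa using h2.ne)

lemma integrable_gauss_one (a b : ℕ) :
    Integrable (fun z : ℂ => z ^ a * conj z ^ b * (Real.exp (-‖z‖ ^ 2) : ℂ)) := by
  refine (integrable_norm_pow_mul_exp (a + b)).mono' ?_ ?_
  · exact Continuous.aestronglyMeasurable (by fun_prop)
  · filter_upwards with z
    rw [norm_mul, norm_mul, norm_pow, norm_pow, RCLike.norm_conj, ← pow_add, Complex.norm_real,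
      Real.norm_of_nonneg (Real.exp_pos _).le]

lemma integral_gauss_one (a b : ℕ) :
    ∫ z : ℂ, z ^ a * conj z ^ b * (Real.exp (-‖z‖ ^ 2) : ℂ) = Real.pi * gaussMoment a b := by
  by_cases h : a = b
  · subst h
    have h := Complex.integral_rpow_mul_exp_neg_rpow (p := 2) (q := (2 * a : ℕ)) (by norm_num)
      (by have : (0 : ℝ) ≤ (2 * a : ℕ) := Nat.cast_nonneg _
          linarith)
    simp only [Real.rpow_natCast, Real.rpow_two] at h
    have e : ∀ z : ℂ, z ^ a * conj z ^ a * (Real.exp (-‖z‖ ^ 2) : ℂ)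
        = ((‖z‖ ^ (2 * a) * Real.exp (-‖z‖ ^ 2) : ℝ) : ℂ) := by
      intro z
      rw [← mul_pow, Complex.mul_conj, Complex.normSq_eq_norm_sq]
      push_cast
      ring
    simp_rw [e]
    rw [integral_complex_ofReal, h]
    have : (((2 * a : ℕ) : ℝ) + 2) / 2 = a + 1 := by push_cast; ring
    rw [this, Real.Gamma_nat_eq_factorial]
    simp [gaussMoment]
  · simp only [gaussMoment, h, if_false, mul_zero]
    set g : ℂ → ℂ := fun z => z ^ a * conj z ^ b * (Real.exp (-‖z‖ ^ 2) : ℂ) with hg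
    -- Rotation by one radian serves all `a ≠ b` at once: it multiplies the integrand by
    -- `e^{i(a-b)}`, which could equal `1` only if `π` were rational.
    let u : Circle := Circle.exp 1
    have h1 : ∫ z, g (rotation u z) = ∫ z, g z :=
      (rotation u).measurePreserving.integral_comp
        (rotation u).toHomeomorph.measurableEmbedding g
    have hu : ‖(u : ℂ)‖ = 1 := Circle.norm_coe u
    have h2 : ∀ z, g (rotation u z) = ((u : ℂ) ^ a * conj (u : ℂ) ^ b) * g z := by
      intro z
      simp only [hg, rotation_apply, map_mul, norm_mul, hu]
      ring_nf
    simp_rw [h2] at h1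
    rw [integral_const_mul] at h1
    have h3 : (u : ℂ) ^ a * conj (u : ℂ) ^ b ≠ 1 := by
      have hu' : (u : ℂ) = Complex.exp Complex.I := by simp [u, Circle.coe_exp]
      rw [hu', ← Complex.exp_conj, ← Complex.exp_nat_mul, ← Complex.exp_nat_mul,
        ← Complex.exp_add, Ne, Complex.exp_eq_one_iff]
      rintro ⟨m, hm⟩
      have hm' : ((a : ℝ) - b) = m * (2 * Real.pi) := by
        have := congrArg Complex.im hm
        simpa [sub_eq_add_neg] using this
      have hm0 : (m : ℝ) ≠ 0 := by
        rintro h0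
        rw [h0, zero_mul, sub_eq_zero] at hm'
        exact h (by exact_mod_cast hm')
      refine irrational_pi ⟨((a : ℚ) - b) / (2 * m), ?_⟩
      push_cast
      rw [hm']
      field_simp
    have h4 : (((u : ℂ) ^ a * conj (u : ℂ) ^ b) - 1) * ∫ z, g z = 0 := by
      rw [sub_mul, h1, one_mul, sub_self]
    rcases mul_eq_zero.1 h4 with h5 | h5
    · exact absurd (sub_eq_zero.1 h5) h3
    · exact h5

/-- The expectation of a polynomial in `z, z̄` under the standard complex Gaussian. -/
def gaussExp (n : ℕ) : Poly n →ₗ[ℂ] ℂ :=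
  (MvPolynomial.basisMonomials (Fin n ⊕ Fin n) ℂ).constr ℂ
    fun m => ∏ i : Fin n, gaussMoment (m (Sum.inl i)) (m (Sum.inr i))

lemma gaussExp_monomial {n : ℕ} (m : (Fin n ⊕ Fin n) →₀ ℕ) (c : ℂ) :
    gaussExp n (MvPolynomial.monomial m c) =
      c * ∏ i : Fin n, gaussMoment (m (Sum.inl i)) (m (Sum.inr i)) := by
  have h : MvPolynomial.monomial m c = c • MvPolynomial.basisMonomials (Fin n ⊕ Fin n) ℂ m := by
    simp [MvPolynomial.smul_monomial]
  rw [h, map_smul, gaussExp, Module.Basis.constr_basis, smul_eq_mul]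

lemma gaussExp_one (n : ℕ) : gaussExp n 1 = 1 := by
  have := gaussExp_monomial (n := n) 0 1
  simpa [gaussMoment] using this

-- Gaussian integration by parts. Expectations of monomials factor over the coordinates, so only the
-- `j`-th factor changes and `gaussMoment_succ_left` applies.
open MvPolynomial in
lemma gaussExp_X_inl_mul {n : ℕ} (j : Fin n) (P : Poly n) :
    gaussExp n (X (Sum.inl j) * P) = gaussExp n (pderiv (Sum.inr j) P) := by
  induction P using MvPolynomial.induction_on' with
  | add p q hp hq => rw [mul_add, map_add, map_add, map_add, hp, hq]
  | monomial m c =>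
    rw [pderiv_monomial, X, monomial_mul, gaussExp_monomial, gaussExp_monomial,
      ← Finset.mul_prod_erase _ _ (Finset.mem_univ j),
      ← Finset.mul_prod_erase _ (fun i => gaussMoment _ _) (Finset.mem_univ j)]
    have h1 : (Finsupp.single (Sum.inl j : Fin n ⊕ Fin n) 1 + m : (Fin n ⊕ Fin n) →₀ ℕ) (Sum.inl j) = m (Sum.inl j) + 1 := by
      simp [add_comm]
    have h2 : (Finsupp.single (Sum.inl j : Fin n ⊕ Fin n) 1 + m : (Fin n ⊕ Fin n) →₀ ℕ) (Sum.inr j) = m (Sum.inr j) := by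
      simp
    have h3 : (m - Finsupp.single (Sum.inr j : Fin n ⊕ Fin n) 1 : (Fin n ⊕ Fin n) →₀ ℕ) (Sum.inl j) = m (Sum.inl j) := by
      simp
    have h4 : (m - Finsupp.single (Sum.inr j : Fin n ⊕ Fin n) 1 : (Fin n ⊕ Fin n) →₀ ℕ) (Sum.inr j)
        = m (Sum.inr j) - 1 := by simp
    rw [h1, h2, h3, h4, gaussMoment_succ_left]
    have h5 : ∀ i ∈ Finset.univ.erase j,
        gaussMoment ((Finsupp.single (Sum.inl j : Fin n ⊕ Fin n) 1 + m : (Fin n ⊕ Fin n) →₀ ℕ) (Sum.inl i))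
          ((Finsupp.single (Sum.inl j : Fin n ⊕ Fin n) 1 + m : (Fin n ⊕ Fin n) →₀ ℕ) (Sum.inr i))
        = gaussMoment ((m - Finsupp.single (Sum.inr j : Fin n ⊕ Fin n) 1 : (Fin n ⊕ Fin n) →₀ ℕ) (Sum.inl i))
          ((m - Finsupp.single (Sum.inr j : Fin n ⊕ Fin n) 1 : (Fin n ⊕ Fin n) →₀ ℕ) (Sum.inr i)) := by
      intro i hi
      have hij : j ≠ i := (Finset.ne_of_mem_erase hi).symm
      congr 1 <;> simp [hij]
    rw [Finset.prod_congr rfl h5]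
    ring

open MvPolynomial in
lemma gaussExp_X_inr_mul {n : ℕ} (j : Fin n) (P : Poly n) :
    gaussExp n (X (Sum.inr j) * P) = gaussExp n (pderiv (Sum.inl j) P) := by
  induction P using MvPolynomial.induction_on' with
  | add p q hp hq => rw [mul_add, map_add, map_add, map_add, hp, hq]
  | monomial m c =>
    rw [pderiv_monomial, X, monomial_mul, gaussExp_monomial, gaussExp_monomial,
      ← Finset.mul_prod_erase _ _ (Finset.mem_univ j),
      ← Finset.mul_prod_erase _ (fun i => gaussMoment _ _) (Finset.mem_univ j)]
    have h1 : (Finsupp.single (Sum.inr j : Fin n ⊕ Fin n) 1 + m : (Fin n ⊕ Fin n) →₀ ℕ) (Sum.inr j) = m (Sum.inr j) + 1 := by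
      simp [add_comm]
    have h2 : (Finsupp.single (Sum.inr j : Fin n ⊕ Fin n) 1 + m : (Fin n ⊕ Fin n) →₀ ℕ) (Sum.inl j) = m (Sum.inl j) := by
      simp
    have h3 : (m - Finsupp.single (Sum.inl j : Fin n ⊕ Fin n) 1 : (Fin n ⊕ Fin n) →₀ ℕ) (Sum.inr j) = m (Sum.inr j) := by
      simp
    have h4 : (m - Finsupp.single (Sum.inl j : Fin n ⊕ Fin n) 1 : (Fin n ⊕ Fin n) →₀ ℕ) (Sum.inl j)
        = m (Sum.inl j) - 1 := by simp
    rw [h1, h2, h3, h4, gaussMoment_comm, gaussMoment_succ_left, gaussMoment_comm]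
    have h5 : ∀ i ∈ Finset.univ.erase j,
        gaussMoment ((Finsupp.single (Sum.inr j : Fin n ⊕ Fin n) 1 + m : (Fin n ⊕ Fin n) →₀ ℕ) (Sum.inl i))
          ((Finsupp.single (Sum.inr j : Fin n ⊕ Fin n) 1 + m : (Fin n ⊕ Fin n) →₀ ℕ) (Sum.inr i))
        = gaussMoment ((m - Finsupp.single (Sum.inl j : Fin n ⊕ Fin n) 1 : (Fin n ⊕ Fin n) →₀ ℕ) (Sum.inl i))
          ((m - Finsupp.single (Sum.inl j : Fin n ⊕ Fin n) 1 : (Fin n ⊕ Fin n) →₀ ℕ) (Sum.inr i)) := by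
      intro i hi
      have hij : j ≠ i := (Finset.ne_of_mem_erase hi).symm
      congr 1 <;> simp [hij]
    rw [Finset.prod_congr rfl h5]
    ring

lemma evalAt_monomial {n : ℕ} (z : EuclideanSpace ℂ (Fin n)) (m : (Fin n ⊕ Fin n) →₀ ℕ) (c : ℂ) :
    evalAt z (MvPolynomial.monomial m c) =
      c * ∏ i, (z i ^ m (Sum.inl i) * conj (z i) ^ m (Sum.inr i)) := by
  rw [evalAt, MvPolynomial.eval_monomial, Finsupp.prod_fintype _ _ (by simp),
    Fintype.prod_sum_type, Finset.prod_mul_distrib]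
  simp

lemma exp_neg_norm_sq {n : ℕ} (x : Fin n → ℂ) :
    (Real.exp (-‖WithLp.toLp 2 x‖ ^ 2) : ℂ) = ∏ i, (Real.exp (-‖x i‖ ^ 2) : ℂ) := by
  rw [EuclideanSpace.norm_sq_eq, ← Finset.sum_neg_distrib, Real.exp_sum]
  push_cast
  rfl

lemma evalAt_toLp_monomial_mul_exp {n : ℕ} (m : (Fin n ⊕ Fin n) →₀ ℕ) (c : ℂ) (x : Fin n → ℂ) :
    evalAt (WithLp.toLp 2 x) (MvPolynomial.monomial m c) *
      (Real.exp (-‖WithLp.toLp 2 x‖ ^ 2) : ℂ) =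
    c * ∏ i, (x i ^ m (Sum.inl i) * conj (x i) ^ m (Sum.inr i) * (Real.exp (-‖x i‖ ^ 2) : ℂ)) := by
  rw [evalAt_monomial, exp_neg_norm_sq, Finset.prod_mul_distrib (g := fun i => (Real.exp _ : ℂ))]
  ring

lemma integrable_pi_gauss {n : ℕ} (P : Poly n) :
    Integrable (fun x : Fin n → ℂ => evalAt (WithLp.toLp 2 x) P *
      (Real.exp (-‖WithLp.toLp 2 x‖ ^ 2) : ℂ)) := by
  induction P using MvPolynomial.induction_on' with
  | add p q hp hq =>
    refine (hp.add hq).congr (.of_forall fun x => ?_)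
    simp [evalAt, add_mul]
  | monomial m c =>
    simp_rw [evalAt_toLp_monomial_mul_exp]
    exact (Integrable.fintype_prod (f := fun (i : Fin n) (z : ℂ) =>
      z ^ m (Sum.inl i) * conj z ^ m (Sum.inr i) * (Real.exp (-‖z‖ ^ 2) : ℂ))
      (fun i => integrable_gauss_one _ _)).const_mul c

lemma integral_pi_gauss {n : ℕ} (P : Poly n) :
    ∫ x : Fin n → ℂ, evalAt (WithLp.toLp 2 x) P *
      (Real.exp (-‖WithLp.toLp 2 x‖ ^ 2) : ℂ) = Real.pi ^ n * gaussExp n P := by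
  induction P using MvPolynomial.induction_on' with
  | add p q hp hq =>
    rw [map_add, mul_add, ← hp, ← hq, ← integral_add (integrable_pi_gauss p) (integrable_pi_gauss q)]
    simp [evalAt, add_mul]
  | monomial m c =>
    simp_rw [evalAt_toLp_monomial_mul_exp]
    rw [integral_const_mul, integral_fintype_prod_volume_eq_prod (fun (i : Fin n) (z : ℂ) =>
      z ^ m (Sum.inl i) * conj z ^ m (Sum.inr i) * (Real.exp (-‖z‖ ^ 2) : ℂ)), gaussExp_monomial]
    simp_rw [integral_gauss_one]
    rw [Finset.prod_mul_distrib]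
    simp
    ring

/-- The constant need not be known, since it cancels on comparison with `P = 1`. Uniqueness of Haar
measure then suffices to relate the Euclidean volume to the product measure. -/
lemma exists_integral_gauss (n : ℕ) : ∃ C : ℂ, C ≠ 0 ∧ ∀ P : Poly n,
    ∫ z : EuclideanSpace ℂ (Fin n), evalAt z P * (Real.exp (-‖z‖ ^ 2) : ℂ) = C * gaussExp n P := by
  let e := (PiLp.continuousLinearEquiv 2 ℝ (fun _ : Fin n => ℂ)).symm
  let ν : Measure (EuclideanSpace ℂ (Fin n)) := Measure.map e volume
  have : ν.IsAddHaarMeasure := ContinuousLinearEquiv.isAddHaarMeasure_map e volume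
  have hν := Measure.isAddLeftInvariant_eq_smul
    (volume : Measure (EuclideanSpace ℂ (Fin n))) ν
  set c := Measure.addHaarScalarFactor (volume : Measure (EuclideanSpace ℂ (Fin n))) ν
  have hc : c ≠ 0 := by
    intro h0
    rw [h0, zero_smul] at hν
    exact NeZero.ne (volume : Measure (EuclideanSpace ℂ (Fin n))) hν
  refine ⟨(c : ℂ) * Real.pi ^ n, ?_, fun P => ?_⟩
  · have : (c : ℝ) ≠ 0 := by exact_mod_cast hc
    have : ((c : ℝ) : ℂ) ≠ 0 := by exact_mod_cast this
    exact mul_ne_zero this (pow_ne_zero _ (by exact_mod_cast Real.pi_ne_zero))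
  · have h := e.toHomeomorph.measurableEmbedding.integral_map (μ := volume)
      fun z : EuclideanSpace ℂ (Fin n) => evalAt z P * (Real.exp (-‖z‖ ^ 2) : ℂ)
    rw [hν, integral_smul_nnreal_measure, mul_assoc, ← integral_pi_gauss]
    exact congrArg (c • ·) h

/-! ### Polar coordinates: from Gaussian integrals to the sphere. -/

lemma finrank_real_euclideanSpace (n : ℕ) :
    Module.finrank ℝ (EuclideanSpace ℂ (Fin n)) = 2 * n := by
  rw [finrank_real_of_complex, finrank_euclideanSpace_fin]

/-- Polar coordinates for the Gaussian integral of a homogeneous function. -/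
lemma integral_homogeneous_mul_exp {n : ℕ} (hn : 0 < n) (F : EuclideanSpace ℂ (Fin n) → ℂ) (N : ℕ)
    (hF : ∀ (r : ℝ), 0 < r → ∀ z, F (r • z) = (r : ℂ) ^ N * F z) :
    ∫ z, F z * (Real.exp (-‖z‖ ^ 2) : ℂ) =
      (∫ ξ : Sph n, F ξ.1 ∂(volume : Measure (EuclideanSpace ℂ (Fin n))).toSphere) *
        ((Real.Gamma (n + N / 2) / 2 : ℝ) : ℂ) := by
  have : Nonempty (Fin n) := ⟨⟨0, hn⟩⟩
  set μ := (volume : Measure (EuclideanSpace ℂ (Fin n)))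
  have hrad : ∫ r : Set.Ioi (0 : ℝ), ((r.1 ^ N * Real.exp (-r.1 ^ 2) : ℝ) : ℂ)
      ∂(Measure.volumeIoiPow (Module.finrank ℝ (EuclideanSpace ℂ (Fin n)) - 1)) =
        ((Real.Gamma (n + N / 2) / 2 : ℝ) : ℂ) := by
    rw [integral_complex_ofReal]
    congr 1
    simp only [Measure.volumeIoiPow, ENNReal.ofReal]
    rw [integral_withDensity_eq_integral_smul,
      integral_subtype_comap measurableSet_Ioi fun a : ℝ ↦ Real.toNNReal
        (a ^ (Module.finrank ℝ (EuclideanSpace ℂ (Fin n)) - 1)) • (a ^ N * Real.exp (-a ^ 2))]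
    -- The density contributes `r^(2n-1)` and homogeneity `r^N`, so the radial integral is `Γ((2n +
    -- N) / 2) / 2`.
    · have h := integral_rpow_mul_exp_neg_rpow (p := 2) (q := (2 * n - 1 + N : ℕ)) (by norm_num)
        (by have : (0 : ℝ) ≤ (2 * n - 1 + N : ℕ) := Nat.cast_nonneg _
            linarith)
      simp only [Real.rpow_natCast, Real.rpow_two] at h
      have e : (((2 * n - 1 + N : ℕ) : ℝ) + 1) / 2 = n + N / 2 := by
        have : ((2 * n - 1 + N : ℕ) : ℝ) + 1 = 2 * n + N := by
          norm_cast; omega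
        rw [this]; ring
      rw [e] at h
      rw [div_eq_inv_mul, ← one_div, ← h]
      refine setIntegral_congr_fun measurableSet_Ioi fun x hx => ?_
      have hx0 : (0 : ℝ) < x := hx
      simp only [NNReal.smul_def, finrank_real_euclideanSpace]
      rw [Real.coe_toNNReal _ (by positivity), smul_eq_mul, pow_add]
      ring
    · exact (measurable_subtype_coe.pow_const _).real_toNNReal
  rw [← hrad, ← integral_prod_mul]
  rw [← (μ.measurePreserving_homeomorphUnitSphereProd).integral_comp
    (Homeomorph.measurableEmbedding _)]
  -- The origin is a null set, and polar coordinates live on its complement.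
  trans ∫ z : ({0}ᶜ : Set (EuclideanSpace ℂ (Fin n))),
    F z.1 * (Real.exp (-‖z.1‖ ^ 2) : ℂ) ∂(μ.comap (↑))
  · rw [integral_subtype_comap (measurableSet_singleton _).compl
      (fun z : EuclideanSpace ℂ (Fin n) => F z * (Real.exp (-‖z‖ ^ 2) : ℂ)),
      restrict_compl_singleton]
  apply integral_congr_ae
  filter_upwards with z
  have hz : 0 < ‖z.1‖ := norm_pos_iff.2 z.2
  simp only [homeomorphUnitSphereProd_apply_snd_coe, homeomorphUnitSphereProd_apply_fst_coe]
  have hz' : (‖z.1‖ : ℂ) ≠ 0 := by exact_mod_cast hz.ne'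
  rw [hF _ (inv_pos.2 hz), Complex.ofReal_inv, inv_pow, Complex.ofReal_mul, Complex.ofReal_pow]
  field_simp

lemma integral_sigma {n : ℕ} (g : Sph n → ℂ) :
    ∫ ξ, g ξ ∂(sigma n) =
      (((volume : Measure (EuclideanSpace ℂ (Fin n))).toSphere.real Set.univ)⁻¹ : ℝ) *
        ∫ ξ, g ξ ∂(volume : Measure (EuclideanSpace ℂ (Fin n))).toSphere := by
  rw [sigma, integral_smul_measure, ENNReal.toReal_inv, Complex.real_smul]
  rfl

/-- Sphere integrals of homogeneous polynomials are Gaussian expectations. -/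
lemma integral_sigma_evalAt {n : ℕ} (hn : 0 < n) (P : Poly n) (N : ℕ)
    (hP : ∀ (r : ℝ), 0 < r → ∀ z, evalAt (r • z) P = (r : ℂ) ^ N * evalAt z P) :
    ∫ ξ : Sph n, evalAt ξ.1 P ∂(sigma n) =
      gaussExp n P * (Real.Gamma n / Real.Gamma (n + N / 2) : ℝ) := by
  obtain ⟨C, hC, h⟩ := exists_integral_gauss n
  -- The case `P = 1` expresses the total mass of the sphere through the same `C`; it normalizes the
  -- measure and shows that the mass is nonzero.
  have h1 := h 1
  have h2 := h P
  rw [integral_homogeneous_mul_exp hn (fun z => evalAt z P) N hP] at h2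
  rw [integral_homogeneous_mul_exp hn (fun z => evalAt z (1 : Poly n)) 0 (by simp [evalAt]),
    gaussExp_one] at h1
  simp only [evalAt, map_one, integral_const, Complex.real_smul, mul_one, Nat.cast_zero, zero_div,
    add_zero] at h1
  rw [integral_sigma]
  set T := (volume : Measure (EuclideanSpace ℂ (Fin n))).toSphere.real Set.univ
  have hT : (T : ℂ) ≠ 0 := by
    intro h0
    rw [h0, zero_mul] at h1
    exact hC h1.symm
  have hg : (Real.Gamma (n + N / 2) : ℂ) ≠ 0 := by
    have : 0 < Real.Gamma (n + N / 2) := Real.Gamma_pos_of_pos (by positivity)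
    exact_mod_cast this.ne'
  rw [← h1] at h2
  generalize Real.Gamma (n + N / 2) = G at h2 hg ⊢
  push_cast at h2 ⊢
  field_simp at h2 ⊢
  linear_combination h2

end

section

open MeasureTheory MvPolynomial

/-! ### Bihomogeneous polynomials and the pairing with zonal monomials -/

/-- A polynomial in `z, z̄` that vanishes at all points is zero. -/
lemma eq_zero_of_eval_conj {ι : Type*} (F : MvPolynomial (ι ⊕ ι) ℂ)
    (h : ∀ z : ι → ℂ, eval (Sum.elim z (fun j => conj (z j))) F = 0) : F = 0 := by
  -- The substitution `z = x + iy`, `z̄ = x - iy`: the resulting polynomial vanishes at all real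
  -- points, hence identically, and the substitution is invertible over `ℂ`.
  let G : MvPolynomial (ι ⊕ ι) ℂ := bind₁ (Sum.elim
    (fun j => X (Sum.inl j) + C Complex.I * X (Sum.inr j))
    (fun j => X (Sum.inl j) - C Complex.I * X (Sum.inr j))) F
  have hG : ∀ x, eval x G = eval (Sum.elim (fun j => x (Sum.inl j) + Complex.I * x (Sum.inr j))
      (fun j => x (Sum.inl j) - Complex.I * x (Sum.inr j))) F := by
    intro x
    change eval₂Hom _ _ (bind₁ _ F) = eval₂Hom _ _ F
    rw [eval₂Hom_bind₁]
    congr 2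
    funext i
    rcases i with j | j <;> simp
  have hG0 : G = 0 := by
    refine funext_set (fun _ => Set.range ((↑) : ℝ → ℂ))
      (fun _ => Set.infinite_range_of_injective Complex.ofReal_injective) fun x hx => ?_
    rw [map_zero, hG, ← h fun j => x (Sum.inl j) + Complex.I * x (Sum.inr j)]
    congr 2
    funext i
    rcases i with j | j
    · rfl
    · obtain ⟨a, ha⟩ := hx (Sum.inl j) trivial
      obtain ⟨b, hb⟩ := hx (Sum.inr j) trivial
      simp only [Sum.elim_inr, ← ha, ← hb]
      simp [sub_eq_add_neg]
  refine funext fun u => ?_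
  -- The inverse substitution, now with the two groups of variables independent.
  have := hG (Sum.elim (fun j => (u (Sum.inl j) + u (Sum.inr j)) / 2)
    (fun j => (u (Sum.inl j) - u (Sum.inr j)) / (2 * Complex.I)))
  rw [hG0, map_zero] at this
  rw [map_zero, this]
  congr 2
  funext i
  have hI := Complex.I_ne_zero
  rcases i with j | j <;> simp <;> field_simp <;> ring

/-- The identity holds formally in two independent variables, so it may be tested at `(2, 1)` and
`(1, 2)`, where the second entry is not the conjugate of the first. -/
lemma exponents_eq_of_pow_mul_conj_pow {a b p q : ℕ}
    (h : ∀ l : ℂ, l ^ a * conj l ^ b = l ^ p * conj l ^ q) : a = p ∧ b = q := by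
  let F : MvPolynomial (Unit ⊕ Unit) ℂ :=
    X (Sum.inl ()) ^ a * X (Sum.inr ()) ^ b - X (Sum.inl ()) ^ p * X (Sum.inr ()) ^ q
  have hF : F = 0 := eq_zero_of_eval_conj F fun z => by
    simp [F, h]
  constructor
  · have h1 : eval (Sum.elim (fun _ => (2 : ℂ)) (fun _ => 1)) F = 0 := by rw [hF, map_zero]
    simp only [F, map_sub, map_mul, map_pow, eval_X, Sum.elim_inl, Sum.elim_inr, one_pow, mul_one,
      sub_eq_zero] at h1
    exact Nat.pow_right_injective le_rfl (by exact_mod_cast h1)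
  · have h1 : eval (Sum.elim (fun _ => (1 : ℂ)) (fun _ => 2)) F = 0 := by rw [hF, map_zero]
    simp only [F, map_sub, map_mul, map_pow, eval_X, Sum.elim_inl, Sum.elim_inr, one_pow, one_mul,
      sub_eq_zero] at h1
    exact Nat.pow_right_injective le_rfl (by exact_mod_cast h1)

/-- The weights counting the degree in `z`. -/
def wtL (n : ℕ) : Fin n ⊕ Fin n → ℕ := Sum.elim (fun _ => 1) (fun _ => 0)

/-- The weights counting the degree in `z̄`. -/
def wtR (n : ℕ) : Fin n ⊕ Fin n → ℕ := Sum.elim (fun _ => 0) (fun _ => 1)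

lemma weight_wtL {n : ℕ} (m : (Fin n ⊕ Fin n) →₀ ℕ) :
    Finsupp.weight (wtL n) m = ∑ i, m (Sum.inl i) := by
  rw [Finsupp.weight_apply, Finsupp.sum_fintype _ _ (by simp), Fintype.sum_sum_type]
  simp [wtL]

lemma weight_wtR {n : ℕ} (m : (Fin n ⊕ Fin n) →₀ ℕ) :
    Finsupp.weight (wtR n) m = ∑ i, m (Sum.inr i) := by
  rw [Finsupp.weight_apply, Finsupp.sum_fintype _ _ (by simp), Fintype.sum_sum_type]
  simp [wtR]

lemma evalAt_eq_sum {n : ℕ} (z : EuclideanSpace ℂ (Fin n)) (P : Poly n) :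
    evalAt z P = ∑ m ∈ P.support,
      coeff m P * ∏ i, (z i ^ m (Sum.inl i) * conj (z i) ^ m (Sum.inr i)) := by
  conv_lhs => rw [P.as_sum, evalAt, map_sum]
  exact Finset.sum_congr rfl fun m _ => evalAt_monomial z m _

/-- For fixed `l` the homogeneity relation is the vanishing of a polynomial at all points, hence of
each coefficient; varying `l` then fixes the exponents. This makes the two degrees algebraic, so
that Euler's identity holds in each group of variables. -/
lemma isWeightedHomogeneous_of_mem_bihomogeneous {n p q : ℕ} {P : Poly n}
    (hP : P ∈ bihomogeneous n p q) :
    P.IsWeightedHomogeneous (wtL n) p ∧ P.IsWeightedHomogeneous (wtR n) q := by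
  have key : ∀ m, coeff m P ≠ 0 → Finsupp.weight (wtL n) m = p ∧ Finsupp.weight (wtR n) m = q := by
    intro m hm
    refine exponents_eq_of_pow_mul_conj_pow fun l => ?_
    let e : ((Fin n ⊕ Fin n) →₀ ℕ) → ℂ := fun m =>
      l ^ Finsupp.weight (wtL n) m * conj l ^ Finsupp.weight (wtR n) m - l ^ p * conj l ^ q
    let Q : Poly n := ∑ m ∈ P.support, monomial m (coeff m P * e m)
    have hQ : Q = 0 := by
      refine eq_zero_of_eval_conj Q fun z => ?_
      have h1 := hP l (WithLp.toLp 2 z)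
      rw [← sub_eq_zero, evalAt_eq_sum, evalAt_eq_sum, Finset.mul_sum,
        ← Finset.sum_sub_distrib] at h1
      change evalAt (WithLp.toLp 2 z) Q = 0
      rw [← h1]
      simp only [Q, evalAt, map_sum]
      refine Finset.sum_congr rfl fun m _ => ?_
      change evalAt (WithLp.toLp 2 z) _ = _
      rw [evalAt_monomial]
      simp only [e, weight_wtL, weight_wtR, PiLp.smul_apply, smul_eq_mul, map_mul, mul_pow,
        Finset.prod_mul_distrib, Finset.prod_pow_eq_pow_sum]
      ring
    have h2 : coeff m Q = coeff m P * e m := by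
      simp only [Q, coeff_sum, coeff_monomial]
      rw [Finset.sum_ite_eq' P.support m, if_pos (mem_support_iff.2 hm)]
    rw [hQ, coeff_zero] at h2
    exact sub_eq_zero.1 ((mul_eq_zero.1 h2.symm).resolve_left hm)
  exact ⟨fun m hm => (key m hm).1, fun m hm => (key m hm).2⟩

lemma sum_X_inl_mul_pderiv {n p : ℕ} {P : Poly n} (hP : P.IsWeightedHomogeneous (wtL n) p) :
    ∑ j, X (Sum.inl j) * pderiv (Sum.inl j) P = p • P := by
  rw [← hP.sum_weight_X_mul_pderiv, Fintype.sum_sum_type]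
  simp [wtL]

lemma sum_X_inr_mul_pderiv {n q : ℕ} {P : Poly n} (hP : P.IsWeightedHomogeneous (wtR n) q) :
    ∑ j, X (Sum.inr j) * pderiv (Sum.inr j) P = q • P := by
  rw [← hP.sum_weight_X_mul_pderiv, Fintype.sum_sum_type]
  simp [wtR]

lemma pderiv_inl_eq_zero {n : ℕ} {P : Poly n} (hP : P.IsWeightedHomogeneous (wtL n) 0)
    (j : Fin n) : pderiv (Sum.inl j) P = 0 := by
  rw [P.as_sum, map_sum]
  refine Finset.sum_eq_zero fun m hm => ?_
  have h := hP (mem_support_iff.1 hm)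
  rw [weight_wtL, Finset.sum_eq_zero_iff] at h
  rw [pderiv_monomial, h j (Finset.mem_univ j)]
  simp

lemma pderiv_inr_eq_zero {n : ℕ} {P : Poly n} (hP : P.IsWeightedHomogeneous (wtR n) 0)
    (j : Fin n) : pderiv (Sum.inr j) P = 0 := by
  rw [P.as_sum, map_sum]
  refine Finset.sum_eq_zero fun m hm => ?_
  have h := hP (mem_support_iff.1 hm)
  rw [weight_wtR, Finset.sum_eq_zero_iff] at h
  rw [pderiv_monomial, h j (Finset.mem_univ j)]
  simp

lemma pderiv_comm {σ : Type*} (i j : σ) (P : MvPolynomial σ ℂ) :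
    pderiv i (pderiv j P) = pderiv j (pderiv i P) := by
  classical
  have h : ⁅pderiv (R := ℂ) i, pderiv (R := ℂ) j⁆ = 0 := by
    ext k
    rw [Derivation.commutator_apply]
    by_cases h1 : i = k <;> by_cases h2 : j = k <;> simp [pderiv_X, h1, h2]
  have h2 := congrArg (fun D : Derivation ℂ _ _ => D P) h
  rw [Derivation.commutator_apply] at h2
  exact sub_eq_zero.1 h2

/-- Polynomials of bidegree `(p, q)` that are harmonic, in terms of weights. -/
structure IsSolid {n : ℕ} (p q : ℕ) (P : Poly n) : Prop where
  left : P.IsWeightedHomogeneous (wtL n) p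
  right : P.IsWeightedHomogeneous (wtR n) q
  harm : ∑ j, pderiv (Sum.inl j) (pderiv (Sum.inr j) P) = 0

lemma laplacian_apply {n : ℕ} (P : Poly n) :
    laplacian n P = (4 : ℂ) • ∑ j, pderiv (Sum.inl j) (pderiv (Sum.inr j) P) := by
  simp [laplacian]

lemma isSolid_of_mem {n p q : ℕ} {P : Poly n} (hP : P ∈ solidHarmonics n p q) : IsSolid p q P := by
  obtain ⟨h1, h2⟩ := hP
  obtain ⟨h3, h4⟩ := isWeightedHomogeneous_of_mem_bihomogeneous h1
  refine ⟨h3, h4, ?_⟩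
  have h5 : laplacian n P = 0 := h2
  rw [laplacian_apply] at h5
  exact (smul_eq_zero.1 h5).resolve_left (by norm_num)

/-! ### Derivatives in the direction of the pole and the linear forms `(z | η)`. -/

/-- The derivative `∑ ηⱼ ∂/∂zⱼ`. -/
def derivL {n : ℕ} (η : EuclideanSpace ℂ (Fin n)) : Derivation ℂ (Poly n) (Poly n) :=
  ∑ j, η j • pderiv (Sum.inl j)

/-- The derivative `∑ η̄ⱼ ∂/∂z̄ⱼ`. -/
def derivR {n : ℕ} (η : EuclideanSpace ℂ (Fin n)) : Derivation ℂ (Poly n) (Poly n) :=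
  ∑ j, conj (η j) • pderiv (Sum.inr j)

/-- The linear form `(z | η)` as a polynomial. -/
def formL {n : ℕ} (η : EuclideanSpace ℂ (Fin n)) : Poly n := ∑ j, conj (η j) • X (Sum.inl j)

/-- The conjugate of the linear form `(z | η)` as a polynomial. -/
def formR {n : ℕ} (η : EuclideanSpace ℂ (Fin n)) : Poly n := ∑ j, η j • X (Sum.inr j)

lemma evalAt_formL {n : ℕ} (η z : EuclideanSpace ℂ (Fin n)) : evalAt z (formL η) = herm z η := by
  simp [evalAt, formL, herm, smul_eval, mul_comm]

lemma evalAt_formR {n : ℕ} (η z : EuclideanSpace ℂ (Fin n)) :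
    evalAt z (formR η) = conj (herm z η) := by
  simp [evalAt, formR, herm, smul_eval, mul_comm]

lemma derivL_apply {n : ℕ} (η : EuclideanSpace ℂ (Fin n)) (P : Poly n) :
    derivL η P = ∑ j, η j • pderiv (Sum.inl j) P := by
  rw [derivL, ← Derivation.coeFnAddMonoidHom_apply, map_sum, Finset.sum_apply]
  rfl

lemma derivR_apply {n : ℕ} (η : EuclideanSpace ℂ (Fin n)) (P : Poly n) :
    derivR η P = ∑ j, conj (η j) • pderiv (Sum.inr j) P := by
  rw [derivR, ← Derivation.coeFnAddMonoidHom_apply, map_sum, Finset.sum_apply]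
  rfl

lemma gaussExp_formL_mul {n : ℕ} (η : EuclideanSpace ℂ (Fin n)) (P : Poly n) :
    gaussExp n (formL η * P) = gaussExp n (derivR η P) := by
  rw [formL, derivR_apply, Finset.sum_mul, map_sum, map_sum]
  refine Finset.sum_congr rfl fun j _ => ?_
  rw [smul_mul_assoc, map_smul, map_smul, gaussExp_X_inl_mul]

lemma gaussExp_formR_mul {n : ℕ} (η : EuclideanSpace ℂ (Fin n)) (P : Poly n) :
    gaussExp n (formR η * P) = gaussExp n (derivL η P) := by
  rw [formR, derivL_apply, Finset.sum_mul, map_sum, map_sum]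
  refine Finset.sum_congr rfl fun j _ => ?_
  rw [smul_mul_assoc, map_smul, map_smul, gaussExp_X_inr_mul]

lemma derivL_formR {n : ℕ} (η : EuclideanSpace ℂ (Fin n)) : derivL η (formR η) = 0 := by
  simp [derivL_apply, formR, pderiv_X]

lemma derivR_formL {n : ℕ} (η : EuclideanSpace ℂ (Fin n)) : derivR η (formL η) = 0 := by
  simp [derivR_apply, formL, pderiv_X]

lemma herm_self {n : ℕ} (η : Sph n) : herm η.1 η.1 = 1 := by
  have h : ‖η.1‖ = 1 := by simp
  have h2 := EuclideanSpace.norm_sq_eq η.1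
  rw [h] at h2
  have h3 : ((∑ i, ‖η.1 i‖ ^ 2 : ℝ) : ℂ) = 1 := by rw [← h2]; norm_num
  rw [herm, ← h3]
  push_cast
  exact Finset.sum_congr rfl fun i _ => Complex.mul_conj' _

lemma derivR_formR {n : ℕ} (η : Sph n) : derivR η.1 (formR η.1) = 1 := by
  have h := herm_self η
  simp only [derivR_apply, formR, map_sum, Derivation.map_smul, pderiv_X, Pi.single_apply]
  simp only [Sum.inr.injEq, smul_ite, smul_zero, Finset.mem_univ, if_true,
    Finset.sum_ite_eq]
  simp_rw [smul_smul, ← Finset.sum_smul]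
  exact (congrArg (· • (1 : Poly n)) h).trans (one_smul ℂ 1)

lemma harm_derivR {n : ℕ} (η : EuclideanSpace ℂ (Fin n)) {P : Poly n}
    (h : ∑ j, pderiv (Sum.inl j) (pderiv (Sum.inr j) P) = 0) :
    ∑ j, pderiv (Sum.inl j) (pderiv (Sum.inr j) (derivR η P)) = 0 := by
  have : ∑ j, pderiv (Sum.inl j) (pderiv (Sum.inr j) (derivR η P)) =
      derivR η (∑ j, pderiv (Sum.inl j) (pderiv (Sum.inr j) P)) := by
    simp only [derivR_apply, map_sum, Derivation.map_smul]
    refine Finset.sum_congr rfl fun j _ => Finset.sum_congr rfl fun i _ => ?_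
    rw [pderiv_comm (Sum.inr j) (Sum.inr i), pderiv_comm (Sum.inl j) (Sum.inr i)]
  rw [this, h, map_zero]

lemma harm_derivL {n : ℕ} (η : EuclideanSpace ℂ (Fin n)) {P : Poly n}
    (h : ∑ j, pderiv (Sum.inl j) (pderiv (Sum.inr j) P) = 0) :
    ∑ j, pderiv (Sum.inl j) (pderiv (Sum.inr j) (derivL η P)) = 0 := by
  have : ∑ j, pderiv (Sum.inl j) (pderiv (Sum.inr j) (derivL η P)) =
      derivL η (∑ j, pderiv (Sum.inl j) (pderiv (Sum.inr j) P)) := by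
    simp only [derivL_apply, map_sum, Derivation.map_smul]
    refine Finset.sum_congr rfl fun j _ => Finset.sum_congr rfl fun i _ => ?_
    rw [pderiv_comm (Sum.inr j) (Sum.inl i), pderiv_comm (Sum.inl j) (Sum.inl i)]
  rw [this, h, map_zero]

lemma isWeightedHomogeneous_sum_smul {n d : ℕ} {w : Fin n ⊕ Fin n → ℕ} (c : Fin n → ℂ)
    (P : Fin n → Poly n) (h : ∀ j, (P j).IsWeightedHomogeneous w d) :
    (∑ j, c j • P j).IsWeightedHomogeneous w d :=
  Submodule.sum_mem (weightedHomogeneousSubmodule ℂ w d) fun j _ =>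
    Submodule.smul_mem _ _ (h j)

lemma IsSolid.derivR {n p q : ℕ} {P : Poly n} (h : IsSolid p (q + 1) P)
    (η : EuclideanSpace ℂ (Fin n)) : IsSolid p q (derivR η P) := by
  refine ⟨?_, ?_, harm_derivR η h.harm⟩ <;> rw [derivR_apply]
  · exact isWeightedHomogeneous_sum_smul _ _ fun j => h.left.pderiv (by simp [wtL])
  · exact isWeightedHomogeneous_sum_smul _ _ fun j => h.right.pderiv (by simp [wtR])

lemma IsSolid.derivL {n p q : ℕ} {P : Poly n} (h : IsSolid (p + 1) q P)
    (η : EuclideanSpace ℂ (Fin n)) : IsSolid p q (derivL η P) := by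
  refine ⟨?_, ?_, harm_derivL η h.harm⟩ <;> rw [derivL_apply]
  · exact isWeightedHomogeneous_sum_smul _ _ fun j => h.left.pderiv (by simp [wtL])
  · exact isWeightedHomogeneous_sum_smul _ _ fun j => h.right.pderiv (by simp [wtR])

/-- At the point `η` itself this derivative coincides with the Euler operator `∑ z̄ⱼ ∂/∂z̄ⱼ`. -/
lemma IsSolid.evalAt_derivR {n p q : ℕ} {P : Poly n} (h : IsSolid p q P)
    (η : EuclideanSpace ℂ (Fin n)) : evalAt η (ComplexSphere.derivR η P) = q * evalAt η P := by
  have := congrArg (evalAt η) (sum_X_inr_mul_pderiv h.right)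
  simpa [evalAt, derivR_apply, smul_eval] using this

lemma IsSolid.evalAt_derivL {n p q : ℕ} {P : Poly n} (h : IsSolid p q P)
    (η : EuclideanSpace ℂ (Fin n)) : evalAt η (ComplexSphere.derivL η P) = p * evalAt η P := by
  have := congrArg (evalAt η) (sum_X_inl_mul_pderiv h.left)
  simpa [evalAt, derivL_apply, smul_eval] using this

lemma IsSolid.derivR_eq_zero {n p : ℕ} {P : Poly n} (h : IsSolid p 0 P)
    (η : EuclideanSpace ℂ (Fin n)) : ComplexSphere.derivR η P = 0 := by
  simp [derivR_apply, pderiv_inr_eq_zero h.right]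

lemma IsSolid.derivL_eq_zero {n q : ℕ} {P : Poly n} (h : IsSolid 0 q P)
    (η : EuclideanSpace ℂ (Fin n)) : ComplexSphere.derivL η P = 0 := by
  simp [derivL_apply, pderiv_inl_eq_zero h.left]

/-- By Euler and integration by parts, `p` times the expectation is the expectation of `∑
∂²P/∂zⱼ∂z̄ⱼ = 0`, and likewise for `q`. In bidegree `(0, 0)` the polynomial is constant. -/
lemma IsSolid.gaussExp_eq {n p q : ℕ} {P : Poly n} (h : IsSolid p q P)
    (η : EuclideanSpace ℂ (Fin n)) :
    gaussExp n P = if p = 0 ∧ q = 0 then evalAt η P else 0 := by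
  have hl : (p : ℂ) * gaussExp n P = 0 := by
    have := congrArg (gaussExp n) (sum_X_inl_mul_pderiv h.left)
    rw [map_sum] at this
    simp_rw [gaussExp_X_inl_mul, pderiv_comm (Sum.inr _) (Sum.inl _)] at this
    rw [← map_sum, h.harm, map_zero, map_nsmul, nsmul_eq_mul] at this
    exact this.symm
  have hr : (q : ℂ) * gaussExp n P = 0 := by
    have := congrArg (gaussExp n) (sum_X_inr_mul_pderiv h.right)
    rw [map_sum] at this
    simp_rw [gaussExp_X_inr_mul] at this
    rw [← map_sum, h.harm, map_zero, map_nsmul, nsmul_eq_mul] at this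
    exact this.symm
  split_ifs with h0
  · obtain ⟨rfl, rfl⟩ := h0
    have hP : P = C (coeff 0 P) := by
      ext m
      rw [coeff_C]
      split_ifs with hm
      · rw [hm]
      · by_contra hc
        have h1 := h.left hc
        have h2 := h.right hc
        rw [weight_wtL, Finset.sum_eq_zero_iff] at h1
        rw [weight_wtR, Finset.sum_eq_zero_iff] at h2
        refine hm (Finsupp.ext fun i => ?_)
        rcases i with i | i
        · exact (h1 i (Finset.mem_univ i)).symm
        · exact (h2 i (Finset.mem_univ i)).symm
    rw [hP, C_eq_smul_one, map_smul, gaussExp_one]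
    simp [evalAt]
  · rw [not_and_or] at h0
    rcases h0 with h0 | h0
    · exact (mul_eq_zero.1 hl).resolve_left (by exact_mod_cast h0)
    · exact (mul_eq_zero.1 hr).resolve_left (by exact_mod_cast h0)

/-- The Gaussian pairing of a harmonic polynomial of bidegree `(p, q)`, with value one at the pole,
with the monomial `ζʲ ζ̄ᵏ`. -/
def gaussPairing (j k p q : ℕ) : ℂ :=
  if p ≤ j ∧ j + q = k + p then (j.factorial * k.factorial : ℂ) / ((j - p).factorial : ℂ) else 0

/-- Each factor `ζ̄` becomes `derivL`, which does not see the remaining powers of `ζ̄` and lowers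
`p` by one, producing a factor `p` at the pole. -/
lemma IsSolid.gaussExp_mul_formR_pow {n : ℕ} (η : Sph n) (j : ℕ) :
    ∀ {p q : ℕ} {P : Poly n}, IsSolid p q P →
      gaussExp n (P * formR η.1 ^ j) = gaussPairing j 0 p q * evalAt η.1 P := by
  induction j with
  | zero =>
    intro p q P h
    rw [pow_zero, mul_one, h.gaussExp_eq η.1, gaussPairing]
    by_cases h0 : p = 0 ∧ q = 0
    · simp [h0]
    · rw [if_neg h0, if_neg (by omega), zero_mul]
  | succ j ih =>
    intro p q P h
    have h1 : P * formR η.1 ^ (j + 1) = formR η.1 * (P * formR η.1 ^ j) := by ring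
    have h2 : ComplexSphere.derivL η.1 (P * formR η.1 ^ j) =
        ComplexSphere.derivL η.1 P * formR η.1 ^ j := by
      rw [Derivation.leibniz, Derivation.leibniz_pow, derivL_formR]
      simp [mul_comm]
    rw [h1, gaussExp_formR_mul, h2]
    rcases p with _ | p
    · rw [h.derivL_eq_zero, zero_mul, map_zero, gaussPairing, if_neg (by omega), zero_mul]
    · rw [ih (h.derivL η.1), h.evalAt_derivL, ← mul_assoc]
      congr 1
      simp only [gaussPairing]
      by_cases hc : p ≤ j ∧ j + q = 0 + p
      · obtain ⟨rfl, rfl⟩ : p = j ∧ q = 0 := by omega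
        rw [if_pos hc, if_pos (by omega)]
        simp [Nat.factorial_succ]
        ring
      · rw [if_neg hc, if_neg (by omega), zero_mul]

/-- This mirrors the product rule for `derivR` on `P ζᵏ ζ̄ʲ`: it hits either `P` or `ζ̄ʲ`, never
`ζᵏ`. With `i = j - p` the two contributions carry the factors `q` and `i`, and `q + i = k + 1`
turns `k!` into `(k + 1)!`. -/
lemma gaussPairing_succ (j k p q : ℕ) :
    gaussPairing j (k + 1) p q =
      (if q = 0 then 0 else q * gaussPairing j k p (q - 1)) + j * gaussPairing (j - 1) k p q := by
  by_cases hc : p ≤ j ∧ j + q = k + 1 + p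
  · obtain ⟨i, rfl⟩ := Nat.exists_eq_add_of_le hc.1
    have hk : k + 1 = i + q := by omega
    have e1 : p + i - p = i := by omega
    rw [gaussPairing, if_pos hc, e1]
    have hz : (if q = 0 then (0 : ℂ) else q * gaussPairing (p + i) k p (q - 1)) =
        q * (((p + i).factorial * k.factorial : ℂ) / i.factorial) := by
      rcases q with _ | q
      · simp
      · rw [if_neg (by omega), gaussPairing, if_pos (by omega), e1]
    have hz2 : ((p + i : ℕ) : ℂ) * gaussPairing (p + i - 1) k p q =
        i * (((p + i).factorial * k.factorial : ℂ) / i.factorial) := by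
      rcases i with _ | i
      · rw [gaussPairing]
        rcases p with _ | p
        · simp
        · rw [if_neg (by omega)]; simp
      · have e2 : p + (i + 1) - 1 = p + i := by omega
        have e3 : p + i - p = i := by omega
        rw [e2, gaussPairing, if_pos (by omega), e3, ← add_assoc, Nat.factorial_succ,
          Nat.factorial_succ i]
        have : (i.factorial : ℂ) ≠ 0 := by exact_mod_cast i.factorial_ne_zero
        have : (i : ℂ) + 1 ≠ 0 := by exact_mod_cast i.succ_ne_zero
        push_cast
        field_simp
    rw [hz, hz2, Nat.factorial_succ, hk]
    push_cast
    ring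
  · rw [gaussPairing, if_neg hc]
    have hz : (if q = 0 then (0 : ℂ) else q * gaussPairing j k p (q - 1)) = 0 := by
      split_ifs with h
      · rfl
      · rw [gaussPairing, if_neg (by omega), mul_zero]
    have hz2 : (j : ℂ) * gaussPairing (j - 1) k p q = 0 := by
      rcases j with _ | j
      · simp
      · rw [gaussPairing, if_neg (by omega), mul_zero]
    rw [hz, hz2, zero_add]

/-- The pairing of a solid harmonic with the monomials `ζʲ ζ̄ᵏ`, `ζ = (z | η)`. -/
lemma IsSolid.gaussExp_mul {n : ℕ} (η : Sph n) (k : ℕ) :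
    ∀ {j p q : ℕ} {P : Poly n}, IsSolid p q P →
      gaussExp n (P * formL η.1 ^ k * formR η.1 ^ j) = gaussPairing j k p q * evalAt η.1 P := by
  induction k with
  | zero =>
    intro j p q P h
    rw [pow_zero, mul_one, h.gaussExp_mul_formR_pow]
  | succ k ih =>
    intro j p q P h
    have h1 : P * formL η.1 ^ (k + 1) * formR η.1 ^ j =
      formL η.1 * (P * formL η.1 ^ k * formR η.1 ^ j) := by ring
    have h2 : ComplexSphere.derivR η.1 (P * formL η.1 ^ k * formR η.1 ^ j) =
        ComplexSphere.derivR η.1 P * formL η.1 ^ k * formR η.1 ^ j +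
          (j : ℂ) • (P * formL η.1 ^ k * formR η.1 ^ (j - 1)) := by
      rw [Derivation.leibniz, Derivation.leibniz, Derivation.leibniz_pow, Derivation.leibniz_pow,
        derivR_formL, derivR_formR]
      simp only [smul_eq_mul, nsmul_eq_mul, mul_one, mul_zero, zero_add, MvPolynomial.smul_eq_C_mul,
        map_natCast]
      ring
    rw [h1, gaussExp_formL_mul, h2, map_add, map_smul, ih h, gaussPairing_succ, add_mul]
    congr 1
    · rcases q with _ | q
      · rw [h.derivR_eq_zero]; simp
      · rw [ih (h.derivR η.1), h.evalAt_derivR, if_neg (by omega), Nat.add_sub_cancel]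
        push_cast
        ring
    · rw [smul_eq_mul, mul_assoc]

end

section

open MeasureTheory MvPolynomial

/-! ### Pochhammer symbols and disc polynomials -/

lemma poch_zero (r : ℂ) : poch r 0 = 1 := by simp [poch]

lemma poch_succ (r : ℂ) (i : ℕ) : poch r (i + 1) = poch r i * (r + i) := by
  simp [poch, ascPochhammer_succ_eval]

lemma poch_succ_left (r : ℂ) (i : ℕ) : poch r (i + 1) = r * poch (r + 1) i := by
  induction i with
  | zero => simp [poch_succ, poch_zero]
  | succ i ih =>
    rw [poch_succ, ih, poch_succ]
    push_cast
    ring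

lemma poch_add (r : ℂ) (a b : ℕ) : poch r (a + b) = poch r a * poch (r + a) b := by
  induction b with
  | zero => simp [poch_zero]
  | succ b ih =>
    rw [← add_assoc, poch_succ, ih, poch_succ]
    push_cast
    ring

lemma poch_neg_add (a : ℂ) (p : ℕ) : poch (-(a + p)) p = (-1) ^ p * poch (a + 1) p := by
  induction p with
  | zero => simp [poch_zero]
  | succ p ih =>
    rw [poch_succ_left, show -(a + ((p + 1 : ℕ) : ℂ)) + 1 = -(a + p) by push_cast; ring, ih,
      poch_succ]
    push_cast
    ring

lemma poch_ne_zero {r : ℂ} {i : ℕ} (h : ∀ k < i, r + k ≠ 0) : poch r i ≠ 0 := by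
  induction i with
  | zero => simp [poch_zero]
  | succ i ih =>
    rw [poch_succ]
    exact mul_ne_zero (ih fun k hk => h k (hk.trans i.lt_succ_self)) (h i i.lt_succ_self)

lemma poch_natCast_succ_ne_zero (a i : ℕ) : poch (a + 1) i ≠ 0 :=
  poch_ne_zero fun k _ => by exact_mod_cast (by omega : a + 1 + k ≠ 0)

lemma poch_neg_natCast_ne_zero {c i : ℕ} (h : i ≤ c) : poch (-c) i ≠ 0 := by
  refine poch_ne_zero fun k hk hc => ?_
  have : (k : ℂ) = c := by linear_combination hc
  have : k = c := by exact_mod_cast this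
  omega

lemma poch_neg_natCast_eq_zero {q i : ℕ} (h : q < i) : poch (-q) i = 0 := by
  obtain ⟨k, rfl⟩ := Nat.exists_eq_add_of_lt h
  rw [show q + k + 1 = (q + 1) + k by ring, poch_add, poch_succ]
  simp

lemma conj_poch (r : ℂ) (i : ℕ) : conj (poch r i) = poch (conj r) i := by
  induction i with
  | zero => simp [poch_zero]
  | succ i ih => rw [poch_succ, poch_succ, map_mul, ih]; simp

/-- The Chu–Vandermonde identity for a terminating hypergeometric series at `1`. -/
lemma sum_poch_div_poch (p : ℕ) : ∀ b c : ℂ, (∀ k < p, c + k ≠ 0) →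
    ∑ i ∈ Finset.range (p + 1), poch (-p) i * poch b i / (poch c i * (i.factorial : ℂ)) =
      poch (c - b) p / poch c p := by
  induction p with
  | zero => intro b c _; simp [poch_zero]
  | succ p ih =>
    intro b c hc
    have hc0 : c ≠ 0 := by simpa using hc 0 p.succ_pos
    have h1 := ih b c fun k hk => hc k (hk.trans p.lt_succ_self)
    have h2 := ih (b + 1) (c + 1) fun k hk => by
      have := hc (k + 1) (Nat.succ_lt_succ hk)
      push_cast at this
      rwa [add_assoc, add_comm 1 (k : ℂ)]
    -- From `(-(p+1))_{i+1} = (-p)_{i+1} - (i+1) (-p)_i`, the sum splits into sums of length `p`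
    -- with parameters `(b, c)` and `(b + 1, c + 1)`.
    have hstep : ∀ i ∈ Finset.range (p + 1),
        poch (-((p + 1 : ℕ) : ℂ)) (i + 1) * poch b (i + 1) /
            (poch c (i + 1) * ((i + 1).factorial : ℂ)) =
          poch (-p) (i + 1) * poch b (i + 1) / (poch c (i + 1) * ((i + 1).factorial : ℂ)) -
            b / c * (poch (-p) i * poch (b + 1) i / (poch (c + 1) i * (i.factorial : ℂ))) := by
      intro i hi
      have hi' : i < p + 1 := Finset.mem_range.1 hi
      have e1 : poch (-((p + 1 : ℕ) : ℂ)) (i + 1) = poch (-p) (i + 1) - (i + 1) * poch (-p) i := by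
        rw [poch_succ_left, show -((p + 1 : ℕ) : ℂ) + 1 = -p by push_cast; ring, poch_succ]
        push_cast
        ring
      have hci : poch (c + 1) i ≠ 0 := poch_ne_zero fun k hk => by
        have := hc (k + 1) (by omega)
        push_cast at this
        rwa [add_assoc, add_comm 1 (k : ℂ)]
      have hf : (i.factorial : ℂ) ≠ 0 := by exact_mod_cast i.factorial_ne_zero
      have hi1 : (i : ℂ) + 1 ≠ 0 := by exact_mod_cast i.succ_ne_zero
      rw [e1, poch_succ_left b, poch_succ_left c, Nat.factorial_succ]
      push_cast
      field_simp
    rw [Finset.sum_range_succ', Finset.sum_congr rfl hstep, Finset.sum_sub_distrib,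
      ← Finset.mul_sum, h2]
    -- The top term vanishes because `(-p)_{p+1} = 0`; what is missing is the term `1` at index
    -- zero.
    have h3 : ∑ i ∈ Finset.range (p + 1), poch (-p) (i + 1) * poch b (i + 1) /
        (poch c (i + 1) * ((i + 1).factorial : ℂ)) = poch (c - b) p / poch c p - 1 := by
      rw [Finset.sum_range_succ, poch_neg_natCast_eq_zero p.lt_succ_self, ← h1,
        Finset.sum_range_succ' (fun i => poch (-p) i * poch b i / (poch c i * (i.factorial : ℂ)))]
      simp [poch_zero]
    rw [h3]
    have hcp : poch c p ≠ 0 := poch_ne_zero fun k hk => hc k (hk.trans p.lt_succ_self)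
    have hcp' : c + p ≠ 0 := hc p p.lt_succ_self
    have hrel : c * poch (c + 1) p = poch c p * (c + p) := by rw [← poch_succ_left, poch_succ]
    have hcp1 : poch (c + 1) p ≠ 0 := by
      intro h0
      rw [h0, mul_zero] at hrel
      exact mul_ne_zero hcp hcp' hrel.symm
    have hx : poch (c + 1) p = poch c p * (c + p) / c := by
      rw [← hrel]; field_simp
    rw [show c + 1 - (b + 1) = c - b by ring, poch_succ, poch_succ, hx]
    simp only [poch_zero, Nat.factorial_zero, Nat.cast_one, mul_one, div_one]
    field_simp
    ring

/-- The coefficient of `w^(p-i) w̄^(q-i)` in the disc polynomial. -/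
def discCoeff (α p q i : ℕ) : ℂ :=
  poch (α + 1) (p + q) / (poch (α + 1) p * poch (α + 1) q) *
    (poch (-p) i * poch (-q) i / (poch (-α - p - q) i * (i.factorial : ℂ)))

lemma discPoly_eq_sum (α p q : ℕ) (w : ℂ) :
    discPoly α p q w = ∑ i ∈ Finset.range (min p q + 1),
      discCoeff α p q i * (w ^ (p - i) * conj w ^ (q - i)) := by
  simp only [discPoly, discCoeff, Finset.mul_sum, mul_assoc]

lemma conj_discCoeff (α p q i : ℕ) : conj (discCoeff α p q i) = discCoeff α p q i := by
  simp [discCoeff, conj_poch]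

lemma discCoeff_zero_ne_zero (α p q : ℕ) : discCoeff α p q 0 ≠ 0 := by
  have h := poch_natCast_succ_ne_zero α
  simp only [discCoeff, poch_zero, Nat.factorial_zero, Nat.cast_one, mul_one, div_one]
  exact div_ne_zero (h _) (mul_ne_zero (h _) (h _))

/-- For `α = n - 2` this is exactly the recursion that harmonicity imposes on the coefficients. -/
lemma discCoeff_succ (α p q i : ℕ) (hi : i < min p q) :
    discCoeff α p q (i + 1) * ((i + 1) * (α + p + q - i)) =
      -(discCoeff α p q i * ((p - i) * (q - i))) := by
  have hcast : (-α - p - q : ℂ) = -((α + p + q : ℕ) : ℂ) := by push_cast; ring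
  have h1 : poch (-α - p - q : ℂ) (i + 1) ≠ 0 := by
    rw [hcast]
    exact poch_neg_natCast_ne_zero (by omega)
  have h2 := h1
  rw [poch_succ] at h2
  have hf : (i.factorial : ℂ) ≠ 0 := by exact_mod_cast i.factorial_ne_zero
  have hi1 : (i : ℂ) + 1 ≠ 0 := by exact_mod_cast i.succ_ne_zero
  obtain ⟨h3, h4⟩ := mul_ne_zero_iff.1 h2
  have e : ((α : ℂ) + p + q - i) = -(-α - p - q + i) := by ring
  simp only [discCoeff]
  rw [poch_succ, poch_succ, poch_succ, Nat.factorial_succ, e]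
  push_cast
  generalize poch (α + 1) (p + q) / (poch (α + 1) p * poch (α + 1) q) = K
  generalize (-(α : ℂ) - p - q + i) = D at *
  field_simp
  ring

/-- The terminating hypergeometric series at `1` is summed by Chu–Vandermonde, and the prefactor is
the reciprocal of the result. -/
lemma discPoly_one (α p q : ℕ) : discPoly α p q 1 = 1 := by
  have h1 : discPoly α p q 1 = poch (α + 1) (p + q) / (poch (α + 1) p * poch (α + 1) q) *
      ∑ i ∈ Finset.range (p + 1),
        poch (-p) i * poch (-q) i / (poch (-α - p - q) i * (i.factorial : ℂ)) := by
    rw [discPoly]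
    congr 1
    simp only [one_pow, map_one, mul_one]
    -- The added terms with `i > q` are zero, since `(-q)_i` is.
    refine Finset.sum_subset (by intro i; simp; omega) fun i hi hi' => ?_
    rw [poch_neg_natCast_eq_zero (q := q) (by simp at hi hi'; omega)]
    simp
  have hcast : ∀ k : ℕ, (-α - p - q : ℂ) + k = -((α + p + q : ℕ) : ℂ) + k := fun k => by
    push_cast; ring
  rw [h1, sum_poch_div_poch]
  · rw [show (-α - p - q : ℂ) - -q = -(α + p) by ring, poch_neg_add,
      show (-α - p - q : ℂ) = -((α + q : ℂ) + p) by ring, poch_neg_add, add_comm p q, poch_add]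
    have h2 := poch_natCast_succ_ne_zero α p
    have h3 := poch_natCast_succ_ne_zero α q
    have h4 := poch_natCast_succ_ne_zero (α + q) p
    rw [show ((α : ℂ) + 1 + q) = α + q + 1 by ring]
    push_cast at h4
    have h5 : ((-1 : ℂ)) ^ p ≠ 0 := pow_ne_zero _ (by norm_num)
    field_simp
  · intro k hk h0
    rw [hcast] at h0
    have : (k : ℂ) = ((α + p + q : ℕ) : ℂ) := by linear_combination h0
    have : k = α + p + q := by exact_mod_cast this
    omega

/-! ### The zonal harmonics are harmonic -/

/-- The polynomial `|z|²`. -/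
def normSqPoly (n : ℕ) : Poly n := ∑ j, X (Sum.inl j) * X (Sum.inr j)

lemma evalAt_normSqPoly {n : ℕ} (z : EuclideanSpace ℂ (Fin n)) :
    evalAt z (normSqPoly n) = herm z z := by
  simp [evalAt, normSqPoly, herm]

lemma pderiv_inr_formR {n : ℕ} (η : EuclideanSpace ℂ (Fin n)) (j : Fin n) :
    pderiv (Sum.inr j) (formR η) = C (η j) := by
  simp only [formR, map_sum, Derivation.map_smul, pderiv_X, Pi.single_apply]
  simp [MvPolynomial.smul_eq_C_mul]

lemma pderiv_inl_formL {n : ℕ} (η : EuclideanSpace ℂ (Fin n)) (j : Fin n) :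
    pderiv (Sum.inl j) (formL η) = C (conj (η j)) := by
  simp only [formL, map_sum, Derivation.map_smul, pderiv_X, Pi.single_apply]
  simp [MvPolynomial.smul_eq_C_mul]

lemma pderiv_inl_formR {n : ℕ} (η : EuclideanSpace ℂ (Fin n)) (j : Fin n) :
    pderiv (Sum.inl j) (formR η) = 0 := by
  simp [formR, pderiv_X]

lemma pderiv_inr_formL {n : ℕ} (η : EuclideanSpace ℂ (Fin n)) (j : Fin n) :
    pderiv (Sum.inr j) (formL η) = 0 := by
  simp [formL, pderiv_X]

lemma pderiv_inl_normSqPoly {n : ℕ} (j : Fin n) :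
    pderiv (Sum.inl j) (normSqPoly n) = X (Sum.inr j) := by
  simp only [normSqPoly, map_sum, Derivation.leibniz, pderiv_X, Pi.single_apply]
  simp

lemma pderiv_inr_normSqPoly {n : ℕ} (j : Fin n) :
    pderiv (Sum.inr j) (normSqPoly n) = X (Sum.inl j) := by
  simp only [normSqPoly, map_sum, Derivation.leibniz, pderiv_X, Pi.single_apply]
  simp

lemma natCast_mul_pow_pred {R : Type*} [CommRing R] (x : R) (b : ℕ) :
    (b : R) * (x * x ^ (b - 1)) = b * x ^ b := by
  rcases b with _ | b
  · simp
  · rw [Nat.add_sub_cancel, ← pow_succ']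

/-- In the factor `n + a + b + i - 1`, `n` comes from differentiating `zⱼ` and summing over `j`, `a
+ b` from the mixed terms with `ζ` and `ζ̄`, and `i - 1` from differentiating the power of `|z|²`
twice. The first summand uses `|η| = 1`. -/
lemma harm_formL_pow_mul {n : ℕ} (η : Sph n) (a b i : ℕ) :
    ∑ j, pderiv (Sum.inl j) (pderiv (Sum.inr j)
        (formL η.1 ^ a * formR η.1 ^ b * normSqPoly n ^ i)) =
      ((a : ℂ) * b) • (formL η.1 ^ (a - 1) * formR η.1 ^ (b - 1) * normSqPoly n ^ i) +
      ((i : ℂ) * (n + a + b + i - 1)) •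
        (formL η.1 ^ a * formR η.1 ^ b * normSqPoly n ^ (i - 1)) := by
  set A := formL η.1
  set B := formR η.1
  set N := normSqPoly n
  have hterm : ∀ j, pderiv (Sum.inl j) (pderiv (Sum.inr j) (A ^ a * B ^ b * N ^ i)) =
      ((a : Poly n) * (b : Poly n) * A ^ (a - 1) * B ^ (b - 1) * N ^ i) * (C (η.1 j) * C (conj (η.1 j))) +
      ((b : Poly n) * (i : Poly n) * A ^ a * B ^ (b - 1) * N ^ (i - 1)) * (C (η.1 j) * X (Sum.inr j)) +
      ((i : Poly n) * A ^ a * B ^ b * N ^ (i - 1)) +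
      ((i : Poly n) * (a : Poly n) * A ^ (a - 1) * B ^ b * N ^ (i - 1)) * (C (conj (η.1 j)) * X (Sum.inl j)) +
      ((i : Poly n) * ((i - 1 : ℕ) : Poly n) * A ^ a * B ^ b * N ^ (i - 1 - 1)) *
        (X (Sum.inl j) * X (Sum.inr j)) := by
    intro j
    have h1 : pderiv (Sum.inr j) (A ^ a * B ^ b * N ^ i) =
        (b : Poly n) * A ^ a * B ^ (b - 1) * N ^ i * C (η.1 j) +
        (i : Poly n) * A ^ a * B ^ b * N ^ (i - 1) * X (Sum.inl j) := by
      simp only [Derivation.leibniz, Derivation.leibniz_pow, A, B, N, pderiv_inr_formL,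
        pderiv_inr_formR, pderiv_inr_normSqPoly, smul_eq_mul, nsmul_eq_mul]
      ring
    rw [h1]
    simp only [map_add, Derivation.leibniz, Derivation.leibniz_pow, A, B, N, pderiv_inl_formL,
      pderiv_inl_formR, pderiv_inl_normSqPoly, smul_eq_mul, nsmul_eq_mul, pderiv_C,
      pderiv_X_self, Derivation.map_natCast]
    ring
  have hη : (∑ j, C (η.1 j) * C (conj (η.1 j)) : Poly n) = 1 := by
    simp_rw [← C_mul]
    rw [← map_sum]
    exact (congrArg C (herm_self η)).trans C_1
  have hB : (∑ j, C (η.1 j) * X (Sum.inr j) : Poly n) = B := by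
    simp [B, formR, MvPolynomial.smul_eq_C_mul]
  have hA : (∑ j, C (conj (η.1 j)) * X (Sum.inl j) : Poly n) = A := by
    simp [A, formL, MvPolynomial.smul_eq_C_mul]
  have hN : (∑ j, X (Sum.inl j) * X (Sum.inr j) : Poly n) = N := rfl
  simp_rw [hterm]
  simp only [Finset.sum_add_distrib, ← Finset.mul_sum, hη, hB, hA, hN, Finset.sum_const,
    Finset.card_univ, Fintype.card_fin, nsmul_eq_mul]
  have e1 := natCast_mul_pow_pred B b
  have e2 := natCast_mul_pow_pred A a
  have e3 := natCast_mul_pow_pred N (i - 1)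
  have e4 : (i : Poly n) * ((i - 1 : ℕ) : Poly n) = i * (i - 1) := by
    rcases i with _ | i
    · simp
    · simp
  simp only [MvPolynomial.smul_eq_C_mul, map_mul, map_add, map_sub, map_natCast, map_one]
  linear_combination (i * A ^ a * N ^ (i - 1)) * e1 + (i * B ^ b * N ^ (i - 1)) * e2 +
    (i * A ^ a * B ^ b) * e3 + A ^ a * B ^ b * N ^ (i - 1) * e4

/-- The solid zonal harmonic. -/
def zonalPoly {n : ℕ} (η : Sph n) (p q : ℕ) : Poly n :=
  ∑ i ∈ Finset.range (min p q + 1), discCoeff (n - 2) p q i •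
    (formL η.1 ^ (p - i) * formR η.1 ^ (q - i) * normSqPoly n ^ i)

lemma harm_zonalPoly {n : ℕ} (hn : 2 ≤ n) (η : Sph n) (p q : ℕ) :
    ∑ j, pderiv (Sum.inl j) (pderiv (Sum.inr j) (zonalPoly η p q)) = 0 := by
  have h1 : ∑ j, pderiv (Sum.inl j) (pderiv (Sum.inr j) (zonalPoly η p q)) =
      ∑ i ∈ Finset.range (min p q + 1), discCoeff (n - 2) p q i •
        ∑ j, pderiv (Sum.inl j) (pderiv (Sum.inr j)
          (formL η.1 ^ (p - i) * formR η.1 ^ (q - i) * normSqPoly n ^ i)) := by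
    simp only [zonalPoly, map_sum, Derivation.map_smul, Finset.smul_sum]
    rw [Finset.sum_comm]
  rw [h1]
  simp_rw [harm_formL_pow_mul, smul_add, smul_smul]
  -- The first kind of term at index `i` cancels the second kind at `i + 1`. The two end terms
  -- vanish: one of `p - i`, `q - i` is zero at the top, and the factor `i` is zero at the bottom.
  rw [Finset.sum_add_distrib, Finset.sum_range_succ, Finset.sum_range_succ']
  have hlast : ((p - min p q : ℕ) : ℂ) * ((q - min p q : ℕ) : ℂ) = 0 := by
    rcases le_total p q with h | h <;> simp [h]
  rw [hlast]
  simp only [mul_zero, zero_smul, add_zero, Nat.cast_zero, zero_mul]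
  rw [← Finset.sum_add_distrib]
  refine Finset.sum_eq_zero fun i hi => ?_
  have hi' : i < min p q := Finset.mem_range.1 hi
  rw [Nat.sub_sub, Nat.sub_sub, Nat.add_sub_cancel, ← add_smul]
  convert! zero_smul ℂ _
  have h := discCoeff_succ (n - 2) p q i hi'
  rw [Nat.cast_sub hn] at h
  rw [Nat.cast_sub (by omega : i ≤ p), Nat.cast_sub (by omega : i ≤ q),
    Nat.cast_sub (by omega : i + 1 ≤ p), Nat.cast_sub (by omega : i + 1 ≤ q)]
  push_cast at h ⊢
  linear_combination h

lemma herm_smul {n : ℕ} (l : ℂ) (z w : EuclideanSpace ℂ (Fin n)) :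
    herm (l • z) w = l * herm z w := by
  simp [herm, Finset.mul_sum, mul_assoc]

lemma herm_smul_self {n : ℕ} (l : ℂ) (z : EuclideanSpace ℂ (Fin n)) :
    herm (l • z) (l • z) = l * conj l * herm z z := by
  simp only [herm, Finset.mul_sum, PiLp.smul_apply, smul_eq_mul, map_mul]
  exact Finset.sum_congr rfl fun i _ => by ring

lemma evalAt_zonalPoly {n : ℕ} (η : Sph n) (p q : ℕ) (z : EuclideanSpace ℂ (Fin n)) :
    evalAt z (zonalPoly η p q) = ∑ i ∈ Finset.range (min p q + 1), discCoeff (n - 2) p q i *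
      (herm z η.1 ^ (p - i) * conj (herm z η.1) ^ (q - i) * herm z z ^ i) := by
  have h1 := evalAt_formL η.1 z
  have h2 := evalAt_formR η.1 z
  have h3 := evalAt_normSqPoly z
  simp only [evalAt] at h1 h2 h3
  simp [evalAt, zonalPoly, smul_eval, h1, h2, h3]

lemma zonalHarmonic_mem {n : ℕ} (hn : 2 ≤ n) (η : Sph n) (p q : ℕ) :
    zonalHarmonic η p q ∈ surfaceHarmonics n p q := by
  refine ⟨zonalPoly η p q, ⟨fun l z => ?_, ?_⟩, ?_⟩
  · rw [evalAt_zonalPoly, evalAt_zonalPoly, Finset.mul_sum]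
    refine Finset.sum_congr rfl fun i hi => ?_
    have hi' : i ≤ min p q := Nat.lt_succ_iff.1 (Finset.mem_range.1 hi)
    rw [herm_smul_self, herm_smul, map_mul, mul_pow, mul_pow, mul_pow, mul_pow]
    have e1 : l ^ p = l ^ (p - i) * l ^ i := by rw [← pow_add]; congr 1; omega
    have e2 : conj l ^ q = conj l ^ (q - i) * conj l ^ i := by rw [← pow_add]; congr 1; omega
    rw [e1, e2]
    ring
  · change laplacian n _ = 0
    rw [laplacian_apply, harm_zonalPoly hn, smul_zero]
  · funext ξ
    change evalAt ξ.1 _ = _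
    rw [evalAt_zonalPoly, herm_self, zonalHarmonic,
      discPoly_eq_sum]
    simp

lemma zonalHarmonic_self {n : ℕ} (η : Sph n) (p q : ℕ) : zonalHarmonic η p q η = 1 := by
  rw [zonalHarmonic, herm_self, discPoly_one]

end

section

open MeasureTheory MvPolynomial

/-! ### The reproducing property -/

lemma isProbabilityMeasure_sigma {n : ℕ} (hn : 0 < n) : IsProbabilityMeasure (sigma n) := by
  have : Nonempty (Fin n) := ⟨⟨0, hn⟩⟩
  constructor
  rw [sigma, Measure.smul_apply, smul_eq_mul]
  refine ENNReal.inv_mul_cancel ?_ (measure_ne_top _ _)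
  rw [Ne, Measure.measure_univ_eq_zero]
  exact Measure.toSphere_ne_zero _

lemma integrable_of_continuous {n : ℕ} (hn : 0 < n) {g : Sph n → ℂ} (hg : Continuous g) :
    Integrable g (sigma n) := by
  have := isProbabilityMeasure_sigma hn
  exact hg.integrable_of_hasCompactSupport (HasCompactSupport.of_compactSpace g)

lemma continuous_evalAt {n : ℕ} (P : Poly n) : Continuous fun ξ : Sph n => evalAt ξ.1 P := by
  refine (MvPolynomial.continuous_eval P).comp (continuous_pi fun i => ?_)
  rcases i with i | i
  · simp only [Sum.elim_inl]; fun_prop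
  · simp only [Sum.elim_inr]; fun_prop

lemma continuous_of_mem {n p q : ℕ} {h : Sph n → ℂ} (hh : h ∈ surfaceHarmonics n p q) :
    Continuous h := by
  obtain ⟨P, _, rfl⟩ := hh
  exact continuous_evalAt P

lemma continuous_herm {n : ℕ} (η : Sph n) : Continuous fun ξ : Sph n => herm ξ.1 η.1 := by
  unfold herm
  fun_prop

/-- The zonal monomial `ζʲ ζ̄ᵏ`, `ζ = (ξ | η)`. -/
def zonalMonomial {n : ℕ} (η : Sph n) (j k : ℕ) (ξ : Sph n) : ℂ :=
  herm ξ.1 η.1 ^ j * conj (herm ξ.1 η.1) ^ k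

lemma continuous_zonalMonomial {n : ℕ} (η : Sph n) (j k : ℕ) :
    Continuous (zonalMonomial η j k) := by
  have := continuous_herm η
  unfold zonalMonomial
  fun_prop

/-- The pairing of the zonal monomial `ζʲ ζ̄ᵏ` with the surface harmonics of bidegree `(p, q)`. -/
def spherePairing (n j k p q : ℕ) : ℂ :=
  gaussPairing j k p q * ((n - 1).factorial / (n - 1 + j + q).factorial)

/-- The Funk–Hecke formula for zonal monomials. -/
lemma integral_mul_conj_zonalMonomial {n p q : ℕ} (hn : 0 < n) {h : Sph n → ℂ}
    (hh : h ∈ surfaceHarmonics n p q) (η : Sph n) (j k : ℕ) :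
    ∫ ξ, h ξ * conj (zonalMonomial η j k ξ) ∂(sigma n) = spherePairing n j k p q * h η := by
  obtain ⟨P, hP, rfl⟩ := hh
  have hs := isSolid_of_mem hP
  have he : ∀ z, evalAt z (P * formL η.1 ^ k * formR η.1 ^ j) =
      evalAt z P * herm z η.1 ^ k * conj (herm z η.1) ^ j := by
    intro z
    rw [← evalAt_formR, ← evalAt_formL]
    simp [evalAt]
  have h1 : ∀ ξ : Sph n, restrictToSphere n P ξ * conj (zonalMonomial η j k ξ) =
      evalAt ξ.1 (P * formL η.1 ^ k * formR η.1 ^ j) := by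
    intro ξ
    rw [he]
    simp only [restrictToSphere, LinearMap.coe_mk, AddHom.coe_mk, zonalMonomial, map_mul, map_pow,
      Complex.conj_conj]
    ring
  simp_rw [h1]
  rw [integral_sigma_evalAt hn _ (p + q + k + j), hs.gaussExp_mul, spherePairing]
  · change _ = _ * evalAt η.1 P
    by_cases hc : p ≤ j ∧ j + q = k + p
    -- When the pairing is nonzero the total degree is `2 (j + q)`, so the Gamma value is a
    -- factorial.
    · have hN : ((n : ℝ) + ((p + q + k + j : ℕ) : ℝ) / 2) = ((n - 1 + j + q : ℕ) : ℝ) + 1 := by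
        have e1 : p + q + k + j = 2 * (j + q) := by omega
        have e2 : ((n - 1 + j + q : ℕ) : ℝ) + 1 = n + (j + q : ℕ) := by norm_cast; omega
        rw [e1, e2]
        push_cast
        ring
      have hN' : (n : ℝ) = ((n - 1 : ℕ) : ℝ) + 1 := by norm_cast; omega
      rw [hN, Real.Gamma_nat_eq_factorial, hN', Real.Gamma_nat_eq_factorial]
      push_cast
      ring
    · simp [gaussPairing, hc]
  · intro r _ z
    have hr : r • z = (r : ℂ) • z := (Complex.coe_smul r z).symm
    rw [he, he, hr, hP.1 (r : ℂ) z, herm_smul, map_mul, Complex.conj_ofReal]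
    ring

lemma zonalHarmonic_eq_sum {n : ℕ} (η : Sph n) (p q : ℕ) (ξ : Sph n) :
    zonalHarmonic η p q ξ = ∑ i ∈ Finset.range (min p q + 1),
      discCoeff (n - 2) p q i * zonalMonomial η (p - i) (q - i) ξ := by
  rw [zonalHarmonic, discPoly_eq_sum]
  rfl

/-- The squared norm of the zonal harmonic. -/
def zonalNormSq (n p q : ℕ) : ℂ := discCoeff (n - 2) p q 0 * spherePairing n p q p q

lemma integral_mul_conj_zonalHarmonic_eq_sum {n p q : ℕ} (hn : 0 < n) {h : Sph n → ℂ}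
    (hh : h ∈ surfaceHarmonics n p q) (η : Sph n) (p' q' : ℕ) :
    ∫ ξ, h ξ * conj (zonalHarmonic η p' q' ξ) ∂(sigma n) =
      ∑ i ∈ Finset.range (min p' q' + 1),
        discCoeff (n - 2) p' q' i * (spherePairing n (p' - i) (q' - i) p q * h η) := by
  simp_rw [zonalHarmonic_eq_sum, map_sum, map_mul, conj_discCoeff, Finset.mul_sum,
    mul_left_comm (h _)]
  rw [integral_finsetSum]
  · simp_rw [integral_const_mul, integral_mul_conj_zonalMonomial hn hh]
  · intro i _
    refine integrable_of_continuous hn ?_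
    have h1 := continuous_of_mem hh
    have h2 := continuous_zonalMonomial η (p' - i) (q' - i)
    fun_prop

/-- The reproducing property of zonal harmonics. -/
lemma integral_mul_conj_zonalHarmonic {n p q : ℕ} (hn : 0 < n) {h : Sph n → ℂ}
    (hh : h ∈ surfaceHarmonics n p q) (η : Sph n) :
    ∫ ξ, h ξ * conj (zonalHarmonic η p q ξ) ∂(sigma n) = zonalNormSq n p q * h η := by
  rw [integral_mul_conj_zonalHarmonic_eq_sum hn hh, Finset.sum_range_succ', zonalNormSq]
  -- Only the leading monomial survives: in the others the power of `ζ` is less than `p`.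
  rw [Finset.sum_eq_zero, zero_add]
  · simp only [Nat.sub_zero]; ring
  · intro i hi
    have hi' := Finset.mem_range.1 hi
    rw [spherePairing, gaussPairing, if_neg (by omega)]
    simp

lemma integral_mul_conj_zonalHarmonic_of_lt {n p q p' q' : ℕ} (hn : 0 < n) {h : Sph n → ℂ}
    (hh : h ∈ surfaceHarmonics n p q) (η : Sph n) (hp : p' < p) :
    ∫ ξ, h ξ * conj (zonalHarmonic η p' q' ξ) ∂(sigma n) = 0 := by
  rw [integral_mul_conj_zonalHarmonic_eq_sum hn hh]
  refine Finset.sum_eq_zero fun i hi => ?_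
  rw [spherePairing, gaussPairing, if_neg (by omega)]
  simp

/-- Conjugate symmetry reduces to the case where one first degree exceeds the other. Differing first
degrees are all that is needed, because the harmonics in the expansion of a monomial lie on one
diagonal. -/
lemma integral_zonalHarmonic_mul_conj_of_ne {n p q p' q' : ℕ} (hn : 2 ≤ n) (η : Sph n)
    (hp : p ≠ p') :
    ∫ ξ, zonalHarmonic η p q ξ * conj (zonalHarmonic η p' q' ξ) ∂(sigma n) = 0 := by
  rcases lt_or_gt_of_ne hp with h | h
  · have h1 := integral_mul_conj_zonalHarmonic_of_lt (q' := q) (by omega : 0 < n)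
      (zonalHarmonic_mem hn η p' q') η h
    have h2 := congrArg conj h1
    rw [← integral_conj, map_zero] at h2
    rw [← h2]
    congr 1
    funext ξ
    simp [mul_comm]
  · exact integral_mul_conj_zonalHarmonic_of_lt (by omega) (zonalHarmonic_mem hn η p q) η h

lemma zonalNormSq_ne_zero (n p q : ℕ) : zonalNormSq n p q ≠ 0 := by
  refine mul_ne_zero (discCoeff_zero_ne_zero _ _ _) ?_
  rw [spherePairing, gaussPairing, if_pos ⟨le_rfl, add_comm _ _⟩]
  have := fun m : ℕ => (Nat.cast_ne_zero (R := ℂ)).2 m.factorial_ne_zero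
  exact mul_ne_zero (div_ne_zero (mul_ne_zero (this _) (this _)) (this _))
    (div_ne_zero (this _) (this _))

lemma solidHarmonics_le (n p q : ℕ) :
    solidHarmonics n p q ≤ restrictTotalDegree (Fin n ⊕ Fin n) ℂ (p + q) := by
  intro P hP
  have hs := isSolid_of_mem hP
  rw [mem_restrictTotalDegree, totalDegree, Finset.sup_le_iff]
  intro m hm
  have h1 := hs.left (mem_support_iff.1 hm)
  have h2 := hs.right (mem_support_iff.1 hm)
  rw [weight_wtL] at h1
  rw [weight_wtR] at h2
  rw [Finsupp.sum_fintype _ _ (by simp), Fintype.sum_sum_type, h1, h2]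

instance finiteDimensional_surfaceHarmonics (n p q : ℕ) :
    FiniteDimensional ℂ (surfaceHarmonics n p q) := by
  have : FiniteDimensional ℂ (solidHarmonics n p q) :=
    Submodule.finiteDimensional_of_le (solidHarmonics_le n p q)
  exact inferInstanceAs (FiniteDimensional ℂ ((solidHarmonics n p q).map (restrictToSphere n)))

/-- The `L²` inner product on surface harmonics. -/
@[reducible]
def harmonicCore {n : ℕ} (hn : 2 ≤ n) (p q : ℕ) :
    InnerProductSpace.Core ℂ (surfaceHarmonics n p q) where
  inner x y := ∫ ξ, conj (x.1 ξ) * y.1 ξ ∂(sigma n)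
  conj_inner_symm x y := by
    rw [← integral_conj]
    congr 1
    funext ξ
    simp [mul_comm]
  re_inner_nonneg x := by
    have h : ∀ ξ, conj (x.1 ξ) * x.1 ξ = ((‖x.1 ξ‖ ^ 2 : ℝ) : ℂ) := fun ξ => by
      rw [Complex.conj_mul']; push_cast; rfl
    simp_rw [h]
    rw [integral_complex_ofReal]
    exact integral_nonneg fun ξ => by positivity
  add_left x y z := by
    have hx := continuous_of_mem x.2
    have hy := continuous_of_mem y.2
    have hz := continuous_of_mem z.2
    rw [← integral_add]
    · congr 1
      funext ξ
      simp [add_mul]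
    · exact integrable_of_continuous (by omega) (by fun_prop)
    · exact integrable_of_continuous (by omega) (by fun_prop)
  smul_left x y r := by
    rw [← integral_const_mul]
    congr 1
    funext ξ
    simp [mul_assoc]
  definite x hx := by
    have hc := continuous_of_mem x.2
    have h : ∀ ξ, conj (x.1 ξ) * x.1 ξ = ((‖x.1 ξ‖ ^ 2 : ℝ) : ℂ) := fun ξ => by
      rw [Complex.conj_mul']; push_cast; rfl
    have h0 : ∫ ξ, ‖x.1 ξ‖ ^ 2 ∂(sigma n) = 0 := by
      have h1 : ∫ ξ, conj (x.1 ξ) * x.1 ξ ∂(sigma n) = 0 := hx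
      simp_rw [h] at h1
      rw [integral_complex_ofReal] at h1
      exact_mod_cast h1
    rw [integral_eq_zero_iff_of_nonneg (fun ξ => by positivity)] at h0
    · refine Subtype.ext (funext fun η => ?_)
      -- The reproducing property upgrades vanishing almost everywhere to vanishing at every point.
      have h2 := integral_mul_conj_zonalHarmonic (by omega) x.2 η
      rw [integral_eq_zero_of_ae] at h2
      · exact (mul_eq_zero.1 h2.symm).resolve_left (zonalNormSq_ne_zero n p q)
      · filter_upwards [h0] with ξ hξ
        have : x.1 ξ = 0 := by simpa using hξ
        simp [this]
    · have h1 : Integrable (fun ξ => conj (x.1 ξ) * x.1 ξ) (sigma n) :=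
        integrable_of_continuous (by omega) (by fun_prop)
      simp_rw [h] at h1
      exact h1.re

/-- The squared norm of the zonal harmonic is the inverse of the dimension. -/
lemma zonalNormSq_mul_dimH {n : ℕ} (hn : 2 ≤ n) (p q : ℕ) :
    zonalNormSq n p q * (dimH n p q : ℂ) = 1 := by
  have hn0 : 0 < n := by omega
  have := isProbabilityMeasure_sigma hn0
  let core := harmonicCore hn p q
  let _ : NormedAddCommGroup (surfaceHarmonics n p q) := core.toNormedAddCommGroup
  let _ : InnerProductSpace ℂ (surfaceHarmonics n p q) := InnerProductSpace.ofCore core.toCore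
  let b := stdOrthonormalBasis ℂ (surfaceHarmonics n p q)
  have hinner : ∀ x y : surfaceHarmonics n p q,
      inner ℂ x y = ∫ ξ, conj (x.1 ξ) * y.1 ξ ∂(sigma n) := fun _ _ => rfl
  -- Expanding `Z_η` in the basis, with coefficients given by the reproducing property, and
  -- evaluating at `η` gives `1`. Integrating over `η` then counts the basis vectors.
  have hself : ∀ η : Sph n, ∑ i, zonalNormSq n p q * (conj ((b i).1 η) * (b i).1 η) = 1 := by
    intro η
    let Z : surfaceHarmonics n p q := ⟨zonalHarmonic η p q, zonalHarmonic_mem hn η p q⟩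
    have h1 := congrArg (fun x : surfaceHarmonics n p q => conj (x.1 η)) (b.sum_repr' Z)
    simp only [AddSubmonoidClass.coe_finsetSum, Finset.sum_apply, Submodule.coe_smul,
      Pi.smul_apply, smul_eq_mul, map_sum, map_mul] at h1
    have h2 : conj (Z.1 η) = 1 := by
      change conj (zonalHarmonic η p q η) = 1
      rw [zonalHarmonic_self, map_one]
    rw [h2] at h1
    rw [← h1]
    refine Finset.sum_congr rfl fun i _ => ?_
    have h3 : conj (inner ℂ (b i) Z) = zonalNormSq n p q * (b i).1 η := by
      rw [inner_conj_symm, hinner, ← integral_mul_conj_zonalHarmonic hn0 (b i).2 η]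
      congr 1
      funext ξ
      exact mul_comm _ _
    rw [h3]
    ring
  have hint : ∫ η, ∑ i, zonalNormSq n p q * (conj ((b i).1 η) * (b i).1 η) ∂(sigma n) = 1 := by
    simp_rw [hself]
    simp
  rw [integral_finsetSum] at hint
  · simp_rw [integral_const_mul, ← hinner] at hint
    simp only [inner_self_eq_norm_sq_to_K, b.orthonormal.1] at hint
    rw [← hint, dimH]
    simp [mul_comm]
  · intro i _
    have := continuous_of_mem (b i).2
    exact integrable_of_continuous hn0 (by fun_prop)

lemma zonalNormSq_eq_inv {n : ℕ} (hn : 2 ≤ n) (p q : ℕ) :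
    zonalNormSq n p q = ((dimH n p q : ℝ)⁻¹ : ℝ) := by
  rw [eq_comm]
  push_cast
  exact (eq_inv_of_mul_eq_one_left (zonalNormSq_mul_dimH hn p q)).symm

lemma dimH_pos {n : ℕ} (hn : 2 ≤ n) (p q : ℕ) : 0 < dimH n p q := by
  refine Nat.pos_of_ne_zero fun h0 => ?_
  have := zonalNormSq_mul_dimH hn p q
  simp [h0] at this

/-- Zonal harmonics are bounded by their value at the pole. -/
lemma norm_zonalHarmonic_le {n : ℕ} (hn : 2 ≤ n) (η : Sph n) (p q : ℕ) (ξ : Sph n) :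
    ‖zonalHarmonic η p q ξ‖ ≤ 1 := by
  have hn0 : 0 < n := by omega
  have hd : (0 : ℝ) < (dimH n p q : ℝ)⁻¹ := inv_pos.2 (by exact_mod_cast dimH_pos hn p q)
  have hnorm : ∀ η : Sph n, ∫ x, ‖zonalHarmonic η p q x‖ ^ 2 ∂(sigma n) = (dimH n p q : ℝ)⁻¹ := by
    intro η
    have h1 := integral_mul_conj_zonalHarmonic hn0 (zonalHarmonic_mem hn η p q) η
    have h : ∀ ξ, zonalHarmonic η p q ξ * conj (zonalHarmonic η p q ξ) =
        ((‖zonalHarmonic η p q ξ‖ ^ 2 : ℝ) : ℂ) := fun ξ => by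
      rw [Complex.mul_conj']; push_cast; rfl
    simp_rw [h] at h1
    rw [integral_complex_ofReal, zonalHarmonic_self, mul_one, zonalNormSq_eq_inv hn] at h1
    exact_mod_cast h1
  have hcont : ∀ η : Sph n, Continuous (zonalHarmonic η p q) := fun η =>
    continuous_of_mem (zonalHarmonic_mem hn η p q)
  have hint : ∀ η : Sph n, Integrable (fun x => ‖zonalHarmonic η p q x‖ ^ 2) (sigma n) := by
    intro η
    have := isProbabilityMeasure_sigma hn0
    have hc : Continuous fun x => ‖zonalHarmonic η p q x‖ ^ 2 := by
      have := hcont η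
      fun_prop
    exact hc.integrable_of_hasCompactSupport (HasCompactSupport.of_compactSpace _)
  -- The value at `ξ` is reproduced by pairing with the kernel at `ξ`; both kernels have squared
  -- norm `1 / dim`, and `ab ≤ (a² + b²) / 2`.
  have h1 := integral_mul_conj_zonalHarmonic hn0 (zonalHarmonic_mem hn η p q) ξ
  have h2 : ‖zonalNormSq n p q * zonalHarmonic η p q ξ‖ ≤ (dimH n p q : ℝ)⁻¹ := by
    rw [← h1]
    calc ‖∫ x, zonalHarmonic η p q x * conj (zonalHarmonic ξ p q x) ∂(sigma n)‖
        ≤ ∫ x, (‖zonalHarmonic η p q x‖ ^ 2 + ‖zonalHarmonic ξ p q x‖ ^ 2) / 2 ∂(sigma n) := by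
          refine norm_integral_le_of_norm_le (((hint η).add (hint ξ)).div_const 2)
            (.of_forall fun x => ?_)
          rw [norm_mul, RCLike.norm_conj]
          nlinarith [sq_nonneg (‖zonalHarmonic η p q x‖ - ‖zonalHarmonic ξ p q x‖)]
      _ = (dimH n p q : ℝ)⁻¹ := by
          rw [integral_div, integral_add (hint η) (hint ξ), hnorm, hnorm]
          ring
  rw [norm_mul, zonalNormSq_eq_inv hn, Complex.norm_real, Real.norm_of_nonneg hd.le] at h2
  exact le_of_mul_le_mul_left (by rwa [mul_one]) hd

/-! ### Expansion of zonal monomials -/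

/-- The passage from monomials to zonal harmonics on one diagonal is triangular with nonzero leading
coefficients, hence invertible. -/
lemma zonalMonomial_mem_span {n : ℕ} (η : Sph n) (m : ℕ) : ∀ j k, min j k = m →
    zonalMonomial η j k ∈ Submodule.span ℂ
      (Set.range fun i : Fin (m + 1) => zonalHarmonic η (j - i) (k - i)) := by
  induction m using Nat.strong_induction_on with
  | _ m ih =>
    intro j k hm
    set V := Submodule.span ℂ
      (Set.range fun i : Fin (m + 1) => zonalHarmonic η (j - i) (k - i))
    have hZ : zonalHarmonic η j k ∈ V :=
      Submodule.subset_span ⟨0, by simp⟩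
    have hlow : ∀ i < min j k, zonalMonomial η (j - (i + 1)) (k - (i + 1)) ∈ V := by
      intro i hi
      refine Submodule.span_mono ?_ (ih (m - (i + 1)) (by omega) _ _ (by omega))
      rintro _ ⟨l, rfl⟩
      refine ⟨⟨i + 1 + l, by omega⟩, ?_⟩
      simp only [Nat.sub_sub]
    have heq : discCoeff (n - 2) j k 0 • zonalMonomial η j k = zonalHarmonic η j k -
        ∑ i ∈ Finset.range (min j k), discCoeff (n - 2) j k (i + 1) •
          zonalMonomial η (j - (i + 1)) (k - (i + 1)) := by
      funext ξ
      simp only [Pi.sub_apply, Finset.sum_apply, Pi.smul_apply, smul_eq_mul]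
      rw [zonalHarmonic_eq_sum, Finset.sum_range_succ']
      simp
    have hmem : discCoeff (n - 2) j k 0 • zonalMonomial η j k ∈ V := by
      rw [heq]
      exact Submodule.sub_mem _ hZ (Submodule.sum_mem _ fun i hi =>
        Submodule.smul_mem _ _ (hlow i (Finset.mem_range.1 hi)))
    exact (Submodule.smul_mem_iff _ (discCoeff_zero_ne_zero _ _ _)).1 hmem

/-- The expansion of a zonal monomial into zonal harmonics. -/
lemma zonalMonomial_eq_sum {n : ℕ} (hn : 2 ≤ n) (η : Sph n) (j k : ℕ) (ξ : Sph n) :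
    zonalMonomial η j k ξ = ∑ i ∈ Finset.range (min j k + 1),
      spherePairing n j k (j - i) (k - i) * dimH n (j - i) (k - i) *
        zonalHarmonic η (j - i) (k - i) ξ := by
  have hn0 : 0 < n := by omega
  obtain ⟨c, hc⟩ := (Submodule.mem_span_range_iff_exists_fun ℂ).1
    (zonalMonomial_mem_span η (min j k) j k rfl)
  -- Both sides are paired with the `l`-th harmonic: Funk–Hecke evaluates one, orthogonality the
  -- other. The coefficient appears conjugated because the monomial does.
  have hcoef : ∀ l : Fin (min j k + 1),
      c l = spherePairing n j k (j - l) (k - l) * dimH n (j - l) (k - l) := by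
    intro l
    have hZl := zonalHarmonic_mem hn η (j - l) (k - l)
    have h1 := integral_mul_conj_zonalMonomial hn0 hZl η j k
    rw [zonalHarmonic_self, mul_one, ← hc] at h1
    simp only [Finset.sum_apply, Pi.smul_apply, smul_eq_mul, map_sum, map_mul, Finset.mul_sum,
      mul_left_comm _ (conj (c _))] at h1
    rw [integral_finsetSum] at h1
    · simp_rw [integral_const_mul] at h1
      rw [Finset.sum_eq_single l] at h1
      · rw [integral_mul_conj_zonalHarmonic hn0 hZl, zonalHarmonic_self, mul_one] at h1
        have h2 := congrArg conj h1
        have h3 : conj (spherePairing n j k (j - l) (k - l)) =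
            spherePairing n j k (j - l) (k - l) := by
          rw [spherePairing, gaussPairing]
          split_ifs <;> simp
        rw [map_mul, Complex.conj_conj, h3, zonalNormSq_eq_inv hn, Complex.conj_ofReal,
          ← zonalNormSq_eq_inv hn] at h2
        rw [← h2, mul_assoc, zonalNormSq_mul_dimH hn, mul_one]
      · intro i _ hil
        rw [integral_zonalHarmonic_mul_conj_of_ne hn, mul_zero]
        have : (i : ℕ) ≠ l := fun h => hil (Fin.ext h)
        omega
      · simp
    · intro i _
      have h2 := continuous_of_mem hZl
      have h3 := continuous_of_mem (zonalHarmonic_mem hn η (j - i) (k - i))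
      exact integrable_of_continuous hn0 (by fun_prop)
  rw [← hc, Finset.sum_range]
  simp only [Finset.sum_apply, Pi.smul_apply, smul_eq_mul, hcoef]

end

section

open Topology

/-! ### Taylor expansion in `w, w̄` -/

/-- The Taylor coefficients of `φ` at `0` with respect to `w, w̄`. -/
def taylorCoeff (φ : ℂ → ℂ) (jk : ℕ × ℕ) : ℂ :=
  taylorDeriv φ jk.1 jk.2 / ((jk.1.factorial : ℂ) * (jk.2.factorial : ℂ))

lemma analyticOnNhd_dW {φ : ℂ → ℂ} {U : Set ℂ} (h : AnalyticOnNhd ℝ φ U) :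
    AnalyticOnNhd ℝ (dW φ) U := by
  intro w hw
  have h1 := (h w hw).fderiv
  have h2 : ∀ v : ℂ, AnalyticAt ℝ (fun z => fderiv ℝ φ z v) w := fun v =>
    ((ContinuousLinearMap.apply ℝ ℂ v).analyticAt _).comp h1
  have := h2 1
  have := h2 Complex.I
  unfold dW
  fun_prop

lemma analyticOnNhd_dWbar {φ : ℂ → ℂ} {U : Set ℂ} (h : AnalyticOnNhd ℝ φ U) :
    AnalyticOnNhd ℝ (dWbar φ) U := by
  intro w hw
  have h1 := (h w hw).fderiv
  have h2 : ∀ v : ℂ, AnalyticAt ℝ (fun z => fderiv ℝ φ z v) w := fun v =>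
    ((ContinuousLinearMap.apply ℝ ℂ v).analyticAt _).comp h1
  have := h2 1
  have := h2 Complex.I
  unfold dWbar
  fun_prop

lemma analyticOnNhd_iterate_dW {φ : ℂ → ℂ} {U : Set ℂ} (h : AnalyticOnNhd ℝ φ U) (j : ℕ) :
    AnalyticOnNhd ℝ (dW^[j] φ) U := by
  induction j with
  | zero => exact h
  | succ j ih =>
    rw [Function.iterate_succ_apply']
    exact analyticOnNhd_dW ih

lemma analyticOnNhd_iterate_dWbar {φ : ℂ → ℂ} {U : Set ℂ} (h : AnalyticOnNhd ℝ φ U) (j : ℕ) :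
    AnalyticOnNhd ℝ (dWbar^[j] φ) U := by
  induction j with
  | zero => exact h
  | succ j ih =>
    rw [Function.iterate_succ_apply']
    exact analyticOnNhd_dWbar ih

lemma dW_congr {f g : ℂ → ℂ} {U : Set ℂ} (hU : IsOpen U) (h : Set.EqOn f g U) :
    Set.EqOn (dW f) (dW g) U := by
  intro w hw
  simp only [dW, (h.eventuallyEq_of_mem (hU.mem_nhds hw)).fderiv_eq]

lemma dWbar_dW_comm {f : ℂ → ℂ} {U : Set ℂ} (h : AnalyticOnNhd ℝ f U) :
    Set.EqOn (dWbar (dW f)) (dW (dWbar f)) U := by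
  intro w hw
  have hsymm : IsSymmSndFDerivAt ℝ f w :=
    (h w hw).contDiffAt.isSymmSndFDerivAt (n := 2) (by simp)
  have hd : DifferentiableAt ℝ (fderiv ℝ f) w := (h w hw).fderiv.differentiableAt
  have hv : ∀ v : ℂ, DifferentiableAt ℝ (fun z => fderiv ℝ f z v) w := fun v =>
    hd.clm_apply (differentiableAt_const v)
  have hf : ∀ u v : ℂ, fderiv ℝ (fun z => fderiv ℝ f z v) w u = fderiv ℝ (fderiv ℝ f) w u v := by
    intro u v
    rw [fderiv_clm_apply hd (differentiableAt_const v)]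
    simp
  have h1 : ∀ u, fderiv ℝ (dW f) w u = (fderiv ℝ (fderiv ℝ f) w u 1 -
      Complex.I * fderiv ℝ (fderiv ℝ f) w u Complex.I) / 2 := by
    intro u
    have : HasFDerivAt (dW f) _ w := (((hv 1).hasFDerivAt.sub
      ((hv Complex.I).hasFDerivAt.const_mul Complex.I)).mul_const (2⁻¹ : ℂ))
    rw [this.fderiv]
    simp [hf]
    ring
  have h2 : ∀ u, fderiv ℝ (dWbar f) w u = (fderiv ℝ (fderiv ℝ f) w u 1 +
      Complex.I * fderiv ℝ (fderiv ℝ f) w u Complex.I) / 2 := by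
    intro u
    have : HasFDerivAt (dWbar f) _ w := (((hv 1).hasFDerivAt.add
      ((hv Complex.I).hasFDerivAt.const_mul Complex.I)).mul_const (2⁻¹ : ℂ))
    rw [this.fderiv]
    simp [hf]
    ring
  rw [dWbar, dW, h1, h1, h2, h2, hsymm.eq 1 Complex.I]
  ring

lemma dWbar_iterate_dW {f : ℂ → ℂ} {U : Set ℂ} (hU : IsOpen U) (h : AnalyticOnNhd ℝ f U) (j : ℕ) :
    Set.EqOn (dWbar (dW^[j] f)) (dW^[j] (dWbar f)) U := by
  induction j with
  | zero => exact fun _ _ => rfl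
  | succ j ih =>
    rw [Function.iterate_succ_apply', Function.iterate_succ_apply']
    exact (dWbar_dW_comm (analyticOnNhd_iterate_dW h j)).trans (dW_congr hU ih)

lemma hasDerivAt_comp_ofReal_mul {f : ℂ → ℂ} {v : ℂ} {t : ℝ} (h : DifferentiableAt ℝ f (t * v)) :
    HasDerivAt (fun s : ℝ => f (s * v)) (v * dW f (t * v) + conj v * dWbar f (t * v)) t := by
  have h1 : HasDerivAt (fun s : ℝ => (s : ℂ) * v) v t := by
    simpa using (Complex.ofRealCLM.hasDerivAt (x := t)).mul_const v
  have h2 := h.hasFDerivAt.comp_hasDerivAt t h1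
  convert! h2 using 1
  set L := fderiv ℝ f (t * v)
  have hv : v = v.re • (1 : ℂ) + v.im • Complex.I := by
    simp [Complex.re_add_im]
  have hL : L v = v.re * L 1 + v.im * L Complex.I := by
    conv_lhs => rw [hv]
    rw [map_add, map_smul, map_smul, Complex.real_smul, Complex.real_smul]
  rw [hL, dW, dWbar]
  have e1 : v = v.re + v.im * Complex.I := (Complex.re_add_im v).symm
  have e2 : conj v = v.re - v.im * Complex.I := by
    apply Complex.ext <;> simp
  rw [e2]
  conv_lhs => enter [1, 1]; rw [e1]
  linear_combination (-(v.im : ℂ) * L Complex.I) * Complex.I_sq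

lemma ofReal_mul_mem_ball {v : ℂ} (hv : ‖v‖ = 1) {t : ℝ} (ht : t ∈ Metric.ball (0 : ℝ) 1) :
    (t : ℂ) * v ∈ Metric.ball (0 : ℂ) 1 := by
  simpa [hv] using ht

/-- The iterated derivatives along a ray. -/
lemma iteratedDeriv_comp_ofReal_mul {φ : ℂ → ℂ}
    (h : AnalyticOnNhd ℝ φ (Metric.ball (0 : ℂ) 1)) {v : ℂ} (hv : ‖v‖ = 1) (m : ℕ) :
    ∀ t ∈ Metric.ball (0 : ℝ) 1, iteratedDeriv m (fun s : ℝ => φ (s * v)) t =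
      ∑ jk ∈ Finset.HasAntidiagonal.antidiagonal m, (m.choose jk.1 : ℂ) *
        (v ^ jk.1 * conj v ^ jk.2 * (dW^[jk.1] (dWbar^[jk.2] φ)) (t * v)) := by
  induction m with
  | zero => intro t _; simp
  | succ m ih =>
    intro t ht
    have hU := Metric.isOpen_ball (x := (0 : ℂ)) (ε := 1)
    rw [iteratedDeriv_succ, (Set.EqOn.eventuallyEq_of_mem (s := Metric.ball (0 : ℝ) 1) ih
      (Metric.isOpen_ball.mem_nhds ht)).deriv_eq]
    have hmem := ofReal_mul_mem_ball hv ht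
    have hd : HasDerivAt (fun s : ℝ => ∑ jk ∈ Finset.HasAntidiagonal.antidiagonal m, (m.choose jk.1 : ℂ) *
        (v ^ jk.1 * conj v ^ jk.2 * (dW^[jk.1] (dWbar^[jk.2] φ)) (s * v)))
        (∑ jk ∈ Finset.HasAntidiagonal.antidiagonal m, (m.choose jk.1 : ℂ) * (v ^ jk.1 * conj v ^ jk.2 *
          (v * dW (dW^[jk.1] (dWbar^[jk.2] φ)) (t * v) +
            conj v * dWbar (dW^[jk.1] (dWbar^[jk.2] φ)) (t * v)))) t := by
      refine HasDerivAt.fun_sum fun jk _ => ?_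
      refine HasDerivAt.const_mul _ (HasDerivAt.const_mul _ (hasDerivAt_comp_ofReal_mul ?_))
      exact (analyticOnNhd_iterate_dW (analyticOnNhd_iterate_dWbar h _) _ _ hmem).differentiableAt
    rw [hd.deriv, Finset.sum_antidiagonal_choose_succ_mul
      (fun j k => v ^ j * conj v ^ k * (dW^[j] (dWbar^[k] φ)) (t * v)), ← Finset.sum_add_distrib]
    refine Finset.sum_congr rfl fun jk hjk => ?_
    have hjk' := Finset.HasAntidiagonal.mem_antidiagonal.1 hjk
    rw [← Nat.choose_symm_of_eq_add hjk'.symm,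
      dWbar_iterate_dW hU (analyticOnNhd_iterate_dWbar h jk.2) jk.1 hmem,
      ← Function.iterate_succ_apply' dWbar, ← Function.iterate_succ_apply' dW]
    ring

/-- A function analytic on the unit ball of `ℝ` whose Taylor coefficients at `0` are absolutely
summable is the sum of its Taylor series there. -/
lemma hasSum_taylor_of_summable {ψ : ℝ → ℂ} (hψ : AnalyticOnNhd ℝ ψ (Metric.ball (0 : ℝ) 1))
    {c : ℕ → ℂ} (hc : ∀ m, iteratedDeriv m ψ 0 = m.factorial * c m)
    (hs : Summable fun m => ‖c m‖) {t : ℝ} (ht : t ∈ Metric.ball (0 : ℝ) 1) :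
    HasSum (fun m => (t : ℂ) ^ m * c m) (ψ t) := by
  let q : FormalMultilinearSeries ℝ ℝ ℂ := fun m =>
    ContinuousMultilinearMap.mkPiRing ℝ (Fin m) (c m)
  have hcoeff : ∀ m, q.coeff m = c m := fun m => by
    simp [q, FormalMultilinearSeries.coeff]
  have hrad : 1 ≤ q.radius := by
    have := q.le_radius_of_summable (r := 1) (by simpa [q] using hs)
    simpa using this
  have hq := q.hasFPowerSeriesOnBall (zero_lt_one.trans_le hrad)
  have hball : Metric.ball (0 : ℝ) 1 ⊆ Metric.eball 0 q.radius := by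
    rw [← Metric.eball_ofReal, ENNReal.ofReal_one]
    exact Metric.eball_subset_eball hrad
  have hsum : ∀ s ∈ Metric.ball (0 : ℝ) 1, HasSum (fun m => (s : ℂ) ^ m * c m) (q.sum s) := by
    intro s hsb
    have := hq.hasSum (hball hsb)
    simpa [q, zero_add] using this
  -- Equal Taylor coefficients give agreement only near `0`; the identity theorem carries it to the
  -- whole interval.
  have heq : Set.EqOn ψ q.sum (Metric.ball (0 : ℝ) 1) := by
    have h0 : (0 : ℝ) ∈ Metric.ball (0 : ℝ) 1 := by simp
    refine hψ.eqOn_of_preconnected_of_eventuallyEq (hq.analyticOnNhd.mono hball)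
      (convex_ball (0 : ℝ) 1).isPreconnected h0 ?_
    obtain ⟨p, hp⟩ := hψ 0 h0
    have hpc : ∀ m, p.coeff m = c m := by
      intro m
      obtain ⟨r, hr⟩ := hp
      have h1 := hr.factorial_smul 1 m
      rw [← iteratedDeriv_eq_iteratedFDeriv, hc] at h1
      have hf : (m.factorial : ℂ) ≠ 0 := by exact_mod_cast m.factorial_ne_zero
      rw [nsmul_eq_mul] at h1
      exact mul_left_cancel₀ hf h1
    have h1 := hasFPowerSeriesAt_iff.1 hp
    filter_upwards [h1, Metric.isOpen_ball.mem_nhds h0] with s hs1 hs2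
    simp only [zero_add, hpc, Complex.real_smul, Complex.ofReal_pow] at hs1
    exact hs1.unique (hsum s hs2)
  rw [heq ht]
  exact hsum t ht

/-- The Taylor series in `w, w̄` represents the function on the closed unit disc. -/
lemma hasSum_taylorCoeff {φ : ℂ → ℂ} (hcont : ContinuousOn φ (Metric.closedBall (0 : ℂ) 1))
    (h : AnalyticOnNhd ℝ φ (Metric.ball (0 : ℂ) 1))
    (hs : Summable fun jk => ‖taylorCoeff φ jk‖) {w : ℂ} (hw : ‖w‖ ≤ 1) :
    HasSum (fun jk : ℕ × ℕ => taylorCoeff φ jk * (w ^ jk.1 * conj w ^ jk.2)) (φ w) := by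
  have hbound : ∀ (jk : ℕ × ℕ) (w : ℂ), w ∈ Metric.closedBall (0 : ℂ) 1 →
      ‖taylorCoeff φ jk * (w ^ jk.1 * conj w ^ jk.2)‖ ≤ ‖taylorCoeff φ jk‖ := by
    intro jk w hw
    have hw' : ‖w‖ ≤ 1 := by simpa using hw
    rw [norm_mul, norm_mul, norm_pow, norm_pow, RCLike.norm_conj]
    exact mul_le_of_le_one_right (norm_nonneg _)
      (mul_le_one₀ (pow_le_one₀ (norm_nonneg _) hw') (by positivity)
        (pow_le_one₀ (norm_nonneg _) hw'))
  have hsummable : ∀ w ∈ Metric.closedBall (0 : ℂ) 1,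
      Summable fun jk : ℕ × ℕ => taylorCoeff φ jk * (w ^ jk.1 * conj w ^ jk.2) := fun w hw =>
    Summable.of_norm_bounded hs fun jk => hbound jk w hw
  have hin : Set.EqOn φ (fun w => ∑' jk : ℕ × ℕ, taylorCoeff φ jk * (w ^ jk.1 * conj w ^ jk.2))
      (Metric.ball (0 : ℂ) 1) := by
    intro w hw
    obtain ⟨t, v, hv, ht, rfl⟩ : ∃ (t : ℝ) (v : ℂ), ‖v‖ = 1 ∧ t ∈ Metric.ball (0 : ℝ) 1 ∧
        w = t * v := by
      by_cases h0 : w = 0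
      · exact ⟨0, 1, by simp, by simp, by simp [h0]⟩
      · have h1 : (‖w‖ : ℂ) ≠ 0 := by simpa using h0
        refine ⟨‖w‖, w / ‖w‖, ?_, by simpa using hw, by field_simp⟩
        rw [norm_div, Complex.norm_real, norm_norm, div_self (by simpa using h0)]
    -- On the ray through `v` the double series becomes a power series in `t`, grouped by total
    -- degree.
    let F : ℕ × ℕ → ℂ := fun jk => taylorCoeff φ jk * (v ^ jk.1 * conj v ^ jk.2)
    let c : ℕ → ℂ := fun m => ∑ jk ∈ Finset.HasAntidiagonal.antidiagonal m, F jk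
    have hψ : AnalyticOnNhd ℝ (fun s : ℝ => φ (s * v)) (Metric.ball (0 : ℝ) 1) := by
      intro s hsb
      refine AnalyticAt.comp (g := φ) (h _ (ofReal_mul_mem_ball hv hsb)) ?_
      exact (Complex.ofRealCLM.analyticAt s).mul analyticAt_const
    have hc : ∀ m, iteratedDeriv m (fun s : ℝ => φ (s * v)) 0 = m.factorial * c m := by
      intro m
      rw [iteratedDeriv_comp_ofReal_mul h hv m 0 (by simp), Finset.mul_sum]
      refine Finset.sum_congr rfl fun jk hjk => ?_
      have hjk' := Finset.HasAntidiagonal.mem_antidiagonal.1 hjk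
      have h1 : (m.choose jk.1 : ℂ) * (jk.1.factorial * jk.2.factorial) = m.factorial := by
        rw [← hjk', ← Nat.choose_mul_factorial_mul_factorial (Nat.le_add_right jk.1 jk.2),
          Nat.add_sub_cancel_left]
        push_cast
        ring
      have h2 : (jk.1.factorial : ℂ) ≠ 0 := by exact_mod_cast jk.1.factorial_ne_zero
      have h3 : (jk.2.factorial : ℂ) ≠ 0 := by exact_mod_cast jk.2.factorial_ne_zero
      rw [← h1]
      simp only [F, taylorCoeff, taylorDeriv, Complex.ofReal_zero, zero_mul]
      field_simp
    have hFs : Summable fun jk => ‖F jk‖ :=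
      Summable.of_nonneg_of_le (fun _ => norm_nonneg _)
        (fun jk => hbound jk v (by simp [hv])) hs
    have hcs : Summable fun m => ‖c m‖ := by
      have h2 : Summable fun m => ∑ jk ∈ Finset.HasAntidiagonal.antidiagonal m, ‖F jk‖ := by
        have h3 := (Finset.HasAntidiagonal.sigmaAntidiagonalEquivProd (A := ℕ)).summable_iff.2 hFs
        have h4 := h3.sigma' fun m => (hasSum_fintype _).summable
        refine h4.congr fun m => ?_
        rw [tsum_fintype, ← Finset.sum_coe_sort (Finset.HasAntidiagonal.antidiagonal m)]
        rfl
      exact Summable.of_nonneg_of_le (fun _ => norm_nonneg _) (fun m => norm_sum_le _ _) h2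
    have hT := hasSum_taylor_of_summable hψ hc hcs ht
    have hT2 := (hsummable _ (Metric.ball_subset_closedBall hw)).hasSum
    have hT3 := (Finset.HasAntidiagonal.sigmaAntidiagonalEquivProd (A := ℕ)).hasSum_iff.2 hT2
    have hT4 := hT3.sigma fun m => hasSum_fintype _
    refine hT.unique (hT4.congr_fun ?_)
    intro m
    refine Eq.trans ?_ (Finset.sum_coe_sort (Finset.HasAntidiagonal.antidiagonal m)
      fun jk : ℕ × ℕ => taylorCoeff φ jk * ((t * v) ^ jk.1 * conj (t * v) ^ jk.2)).symm
    rw [Finset.mul_sum]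
    refine Finset.sum_congr rfl fun jk hjk => ?_
    rw [← Finset.HasAntidiagonal.mem_antidiagonal.1 hjk, map_mul, Complex.conj_ofReal]
    simp only [F]
    ring
  -- Both sides are continuous on the closed disc and agree on the dense open disc.
  have hcl : Set.EqOn φ (fun w => ∑' jk : ℕ × ℕ, taylorCoeff φ jk * (w ^ jk.1 * conj w ^ jk.2))
      (Metric.closedBall (0 : ℂ) 1) := by
    refine hin.of_subset_closure hcont ?_ Metric.ball_subset_closedBall
      (by rw [closure_ball (0 : ℂ) one_ne_zero])
    refine continuousOn_tsum (fun jk => ?_) hs hbound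
    fun_prop
  have hw' : w ∈ Metric.closedBall (0 : ℂ) 1 := by simpa using hw
  rw [hcl hw']
  exact (hsummable w hw').hasSum

end

section

open MeasureTheory

/-! ### Convergence of the expansion -/

lemma norm_herm_le {n : ℕ} (ξ η : Sph n) : ‖herm ξ.1 η.1‖ ≤ 1 := by
  have h : herm ξ.1 η.1 = inner ℂ η.1 ξ.1 := by
    simp [herm, PiLp.inner_apply, RCLike.inner_apply]
  have h1 := norm_inner_le_norm (𝕜 := ℂ) η.1 ξ.1
  rw [← h] at h1
  simpa using h1

lemma norm_zonalMonomial_le {n : ℕ} (η : Sph n) (j k : ℕ) (ξ : Sph n) :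
    ‖zonalMonomial η j k ξ‖ ≤ 1 := by
  rw [zonalMonomial, norm_mul, norm_pow, norm_pow, RCLike.norm_conj]
  exact mul_le_one₀ (pow_le_one₀ (norm_nonneg _) (norm_herm_le ξ η)) (by positivity)
    (pow_le_one₀ (norm_nonneg _) (norm_herm_le ξ η))

/-- This encodes that the pairing constants are nonnegative reals. -/
lemma ofReal_norm_spherePairing (n j k p q : ℕ) :
    ((‖spherePairing n j k p q‖ : ℝ) : ℂ) = spherePairing n j k p q := by
  have h : spherePairing n j k p q = (((if p ≤ j ∧ j + q = k + p then
      (j.factorial * k.factorial : ℝ) / ((j - p).factorial : ℝ) else 0) *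
      ((n - 1).factorial / (n - 1 + j + q).factorial) : ℝ) : ℂ) := by
    rw [spherePairing, gaussPairing]
    split_ifs <;> push_cast <;> rfl
  rw [h, Complex.norm_real, Real.norm_of_nonneg]
  split_ifs <;> positivity

/-- The expansion of a monomial, evaluated at the pole where the monomial and all harmonics equal
`1`. Since the coefficients are nonnegative, passing to harmonics loses nothing in absolute
convergence. -/
lemma sum_norm_spherePairing {n : ℕ} (hn : 2 ≤ n) (η : Sph n) (j k : ℕ) :
    ∑ i ∈ Finset.range (min j k + 1),
      ‖spherePairing n j k (j - i) (k - i)‖ * dimH n (j - i) (k - i) = 1 := by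
  have h := zonalMonomial_eq_sum hn η j k η
  simp only [zonalMonomial, herm_self, zonalHarmonic_self, one_pow, map_one, mul_one] at h
  apply Complex.ofReal_injective
  simp only [Complex.ofReal_sum, Complex.ofReal_mul, ofReal_norm_spherePairing,
    Complex.ofReal_natCast, Complex.ofReal_one]
  exact h.symm

lemma norm_spherePairing_le {n : ℕ} (hn : 2 ≤ n) (η : Sph n) (p q i : ℕ) :
    ‖spherePairing n (p + i) (q + i) p q‖ ≤ 1 := by
  have h := sum_norm_spherePairing hn η (p + i) (q + i)
  have hi : i ∈ Finset.range (min (p + i) (q + i) + 1) := by simp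
  have h1 := Finset.single_le_sum (f := fun l => ‖spherePairing n (p + i) (q + i) (p + i - l)
    (q + i - l)‖ * (dimH n (p + i - l) (q + i - l) : ℝ)) (fun l _ => by positivity) hi
  simp only [Nat.add_sub_cancel] at h1
  rw [h] at h1
  have hd : (1 : ℝ) ≤ dimH n p q := by exact_mod_cast dimH_pos hn p q
  exact (le_mul_of_one_le_right (norm_nonneg _) hd).trans h1

/-- The factorials `(p + k)! (q + k)!` of the Taylor coefficient cancel those of `gaussPairing`,
which leaves `k!`. -/
lemma factorial_mul_coeffTerm (n : ℕ) (φ : ℂ → ℂ) (p q k : ℕ) :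
    ((n - 1).factorial : ℂ) * coeffTerm n φ p q k =
      taylorCoeff φ (p + k, q + k) * spherePairing n (p + k) (q + k) p q := by
  have hf := fun m : ℕ => (Nat.cast_ne_zero (R := ℂ)).2 m.factorial_ne_zero
  have h1 := hf (p + k)
  have h2 := hf (q + k)
  have h3 := hf k
  have h4 := hf (n - 1 + p + q + k)
  rw [coeffTerm, taylorCoeff, spherePairing, gaussPairing, if_pos (by omega),
    Nat.add_sub_cancel_left, show n - 1 + (p + k) + q = n - 1 + p + q + k by omega]
  field_simp

lemma injective_shift (p q : ℕ) : Function.Injective fun i : ℕ => (p + i, q + i) :=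
  fun i i' h => by simpa using congrArg Prod.fst h

lemma summable_norm_coeffTerm {n : ℕ} (hn : 2 ≤ n) (η : Sph n) {φ : ℂ → ℂ}
    (hs : Summable fun jk => ‖taylorCoeff φ jk‖) (p q : ℕ) :
    Summable fun k => ‖coeffTerm n φ p q k‖ := by
  have hf : ((n - 1).factorial : ℂ) ≠ 0 := by exact_mod_cast (n - 1).factorial_ne_zero
  rw [← summable_mul_left_iff (norm_ne_zero_iff.2 hf)]
  refine Summable.of_nonneg_of_le (fun _ => by positivity) (fun k => ?_)
    (hs.comp_injective (injective_shift p q))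
  rw [← norm_mul, factorial_mul_coeffTerm, norm_mul]
  exact mul_le_of_le_one_right (norm_nonneg _) (norm_spherePairing_le hn η p q k)

lemma hasSum_expansionCoeff {n : ℕ} (hn : 2 ≤ n) (η : Sph n) {φ : ℂ → ℂ}
    (hs : Summable fun jk => ‖taylorCoeff φ jk‖) (p q : ℕ) :
    HasSum (fun k => taylorCoeff φ (p + k, q + k) * spherePairing n (p + k) (q + k) p q)
      (expansionCoeff n φ p q) := by
  simp_rw [← factorial_mul_coeffTerm]
  exact (summable_norm_coeffTerm hn η hs p q).of_norm.hasSum.mul_left _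

/-- Reindexing a triple sum along the diagonals. -/
lemma hasSum_shift_iff {E : Type*} [AddCommMonoid E] [TopologicalSpace E]
    {T : (ℕ × ℕ) × ℕ → E} {s : E} :
    HasSum (fun x : (ℕ × ℕ) × ℕ => if x.2 ≤ min x.1.1 x.1.2 then
      T ((x.1.1 - x.2, x.1.2 - x.2), x.2) else 0) s ↔ HasSum T s := by
  -- The range of this injection is the region `i ≤ min j k`, outside of which the left-hand terms
  -- are zero.
  let g : (ℕ × ℕ) × ℕ → (ℕ × ℕ) × ℕ := fun x => ((x.1.1 + x.2, x.1.2 + x.2), x.2)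
  have hg : Function.Injective g := by
    rintro ⟨⟨p, q⟩, i⟩ ⟨⟨p', q'⟩, i'⟩ h
    simp only [g, Prod.mk.injEq] at h ⊢
    omega
  refine (hg.hasSum_iff (f := fun x : (ℕ × ℕ) × ℕ => if x.2 ≤ min x.1.1 x.1.2 then
    T ((x.1.1 - x.2, x.1.2 - x.2), x.2) else 0) ?_).symm.trans
    (iff_of_eq (congrArg (HasSum · s) (funext fun x => ?_)))
  · rintro ⟨⟨j, k⟩, i⟩ hx
    refine if_neg fun hi => hx ⟨((j - i, k - i), i), ?_⟩
    simp only [le_min_iff] at hi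
    simp [g, hi.1, hi.2]
  · simp [g]

lemma hasSum_ite_le_min {E : Type*} [AddCommMonoid E] [TopologicalSpace E] (j k : ℕ)
    (F : ℕ → E) : HasSum (fun i => if i ≤ min j k then F i else 0)
      (∑ i ∈ Finset.range (min j k + 1), F i) := by
  have h : HasSum (fun i => if i ≤ min j k then F i else 0)
      (∑ i ∈ Finset.range (min j k + 1), if i ≤ min j k then F i else 0) :=
    hasSum_sum_of_ne_finset_zero fun i hi => if_neg fun hi' =>
      hi (Finset.mem_range.2 (Nat.lt_succ_of_le hi'))
  rwa [Finset.sum_congr rfl fun i hi => if_pos (Nat.lt_succ_iff.1 (Finset.mem_range.1 hi))] at h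

/-- The majorant of the spherical harmonic expansion. -/
def majorant (n : ℕ) (φ : ℂ → ℂ) (x : (ℕ × ℕ) × ℕ) : ℝ :=
  ‖taylorCoeff φ (x.1.1 + x.2, x.1.2 + x.2)‖ *
    (‖spherePairing n (x.1.1 + x.2) (x.1.2 + x.2) x.1.1 x.1.2‖ * dimH n x.1.1 x.1.2)

/-- Reindexed by `(j, k) = (p + i, q + i)`, the inner sum over `i` is exactly the norm of the Taylor
coefficient at `(j, k)`. -/
lemma summable_majorant {n : ℕ} (hn : 2 ≤ n) (η : Sph n) {φ : ℂ → ℂ}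
    (hs : Summable fun jk => ‖taylorCoeff φ jk‖) : Summable (majorant n φ) := by
  have hin : ∀ jk : ℕ × ℕ, HasSum (fun i => if i ≤ min jk.1 jk.2 then
      majorant n φ ((jk.1 - i, jk.2 - i), i) else 0) ‖taylorCoeff φ jk‖ := by
    rintro ⟨j, k⟩
    have h := hasSum_ite_le_min j k fun i => majorant n φ ((j - i, k - i), i)
    convert! h using 1
    rw [← mul_one ‖taylorCoeff φ (j, k)‖, ← sum_norm_spherePairing hn η j k, Finset.mul_sum]
    refine Finset.sum_congr rfl fun i hi => ?_
    have hi' := Finset.mem_range.1 hi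
    simp only [majorant]
    rw [Nat.sub_add_cancel (by omega : i ≤ j), Nat.sub_add_cancel (by omega : i ≤ k)]
  have h : Summable fun x : (ℕ × ℕ) × ℕ => if x.2 ≤ min x.1.1 x.1.2 then
      majorant n φ ((x.1.1 - x.2, x.1.2 - x.2), x.2) else 0 := by
    rw [summable_prod_of_nonneg]
    · exact ⟨fun jk => (hin jk).summable, by simpa only [(hin _).tsum_eq] using hs⟩
    · intro x
      simp only [Pi.zero_apply]
      split_ifs
      · unfold majorant; positivity
      · rfl
  exact (hasSum_shift_iff.1 h.hasSum).summable

/-- The terms of the triple series behind the spherical harmonic expansion. -/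
def tripleTerm {n : ℕ} (η : Sph n) (φ : ℂ → ℂ) (ξ : Sph n) (x : (ℕ × ℕ) × ℕ) : ℂ :=
  taylorCoeff φ (x.1.1 + x.2, x.1.2 + x.2) *
    spherePairing n (x.1.1 + x.2) (x.1.2 + x.2) x.1.1 x.1.2 *
      (dimH n x.1.1 x.1.2 * zonalHarmonic η x.1.1 x.1.2 ξ)

lemma norm_tripleTerm_le {n : ℕ} (hn : 2 ≤ n) (η : Sph n) (φ : ℂ → ℂ) (ξ : Sph n)
    (x : (ℕ × ℕ) × ℕ) : ‖tripleTerm η φ ξ x‖ ≤ majorant n φ x := by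
  rw [tripleTerm, majorant, norm_mul, norm_mul, norm_mul, mul_assoc, Complex.norm_natCast]
  gcongr
  exact mul_le_of_le_one_right (Nat.cast_nonneg _) (norm_zonalHarmonic_le hn η _ _ ξ)

lemma hasSum_tripleTerm_fiber {n : ℕ} (hn : 2 ≤ n) (η : Sph n) {φ : ℂ → ℂ}
    (hs : Summable fun jk => ‖taylorCoeff φ jk‖) (ξ : Sph n) (pq : ℕ × ℕ) :
    HasSum (fun i => tripleTerm η φ ξ (pq, i))
      (zonalTerm η (expansionCoeff n φ pq.1 pq.2) pq.1 pq.2 ξ) := by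
  rw [zonalTerm, mul_assoc]
  simp only [tripleTerm]
  exact (hasSum_expansionCoeff hn η hs pq.1 pq.2).mul_right
    ((dimH n pq.1 pq.2 : ℂ) * zonalHarmonic η pq.1 pq.2 ξ)

/-- Summing over `i` at fixed `(j, k)` reassembles the monomials. The fibers over `(p, q)` are
treated in `hasSum_tripleTerm_fiber`; absolute convergence makes both orders legitimate. -/
lemma hasSum_tripleTerm {n : ℕ} (hn : 2 ≤ n) (η : Sph n) {φ : ℂ → ℂ}
    (hs : Summable fun jk => ‖taylorCoeff φ jk‖) (ξ : Sph n) {s : ℂ}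
    (h : HasSum (fun jk : ℕ × ℕ => taylorCoeff φ jk * zonalMonomial η jk.1 jk.2 ξ) s) :
    HasSum (tripleTerm η φ ξ) s := by
  have hsum : Summable (tripleTerm η φ ξ) :=
    Summable.of_norm_bounded (summable_majorant hn η hs) (norm_tripleTerm_le hn η φ ξ)
  have h1 := hasSum_shift_iff.2 hsum.hasSum
  have h2 := HasSum.prod_fiberwise h1 fun jk => hasSum_ite_le_min jk.1 jk.2 fun i =>
    tripleTerm η φ ξ ((jk.1 - i, jk.2 - i), i)
  have h3 : ∀ jk : ℕ × ℕ, ∑ i ∈ Finset.range (min jk.1 jk.2 + 1),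
      tripleTerm η φ ξ ((jk.1 - i, jk.2 - i), i) =
        taylorCoeff φ jk * zonalMonomial η jk.1 jk.2 ξ := by
    rintro ⟨j, k⟩
    rw [zonalMonomial_eq_sum hn, Finset.mul_sum]
    refine Finset.sum_congr rfl fun i hi => ?_
    have hi' := Finset.mem_range.1 hi
    simp only [tripleTerm]
    rw [Nat.sub_add_cancel (by omega : i ≤ j), Nat.sub_add_cancel (by omega : i ≤ k)]
    ring
  simp_rw [h3] at h2
  rw [h.unique h2]
  exact hsum.hasSum

/-- The pairing of a zonal function with a surface harmonic. -/
lemma integral_mul_conj_of_hasSum {n : ℕ} (hn : 2 ≤ n) (η : Sph n) {f : Sph n → ℂ} {φ : ℂ → ℂ}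
    (hs : Summable fun jk => ‖taylorCoeff φ jk‖)
    (hf : ∀ ξ, HasSum (fun jk : ℕ × ℕ => taylorCoeff φ jk * zonalMonomial η jk.1 jk.2 ξ) (f ξ))
    {p q : ℕ} {h : Sph n → ℂ} (hh : h ∈ surfaceHarmonics n p q) :
    ∫ ξ, f ξ * conj (h ξ) ∂(sigma n) = expansionCoeff n φ p q * conj (h η) := by
  have hn0 : 0 < n := by omega
  have hc := continuous_of_mem hh
  let F : ℕ × ℕ → Sph n → ℂ := fun jk ξ =>
    taylorCoeff φ jk * zonalMonomial η jk.1 jk.2 ξ * conj (h ξ)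
  have hFint : ∀ jk, Integrable (F jk) (sigma n) := fun jk => by
    have := continuous_zonalMonomial η jk.1 jk.2
    exact integrable_of_continuous hn0 (by fun_prop)
  have hhint := (integrable_of_continuous hn0 hc).norm
  have hFsum : Summable fun jk => ∫ ξ, ‖F jk ξ‖ ∂(sigma n) := by
    refine Summable.of_nonneg_of_le (fun jk => integral_nonneg fun ξ => norm_nonneg _)
      (fun jk => ?_) (hs.mul_right (∫ ξ, ‖h ξ‖ ∂(sigma n)))
    rw [← integral_const_mul]
    refine integral_mono (hFint jk).norm (hhint.const_mul _) fun ξ => ?_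
    simp only [F, norm_mul, RCLike.norm_conj]
    gcongr
    exact mul_le_of_le_one_right (norm_nonneg _) (norm_zonalMonomial_le η _ _ ξ)
  have h1 := hasSum_integral_of_summable_integral_norm hFint hFsum
  have h2 : ∀ ξ, ∑' jk, F jk ξ = f ξ * conj (h ξ) := fun ξ => ((hf ξ).mul_right _).tsum_eq
  have h3 : ∀ jk : ℕ × ℕ, ∫ ξ, F jk ξ ∂(sigma n) =
      taylorCoeff φ jk * spherePairing n jk.1 jk.2 p q * conj (h η) := by
    intro jk
    have h4 := congrArg conj (integral_mul_conj_zonalMonomial hn0 hh η jk.1 jk.2)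
    rw [← integral_conj, map_mul, ← ofReal_norm_spherePairing, Complex.conj_ofReal,
      ofReal_norm_spherePairing] at h4
    rw [mul_assoc, ← h4, ← integral_const_mul]
    congr 1
    funext ξ
    simp only [F, map_mul, Complex.conj_conj]
    ring
  simp_rw [h2, h3] at h1
  have h5 : HasSum (fun i : ℕ => taylorCoeff φ (p + i, q + i) *
      spherePairing n (p + i) (q + i) p q * conj (h η)) (∫ ξ, f ξ * conj (h ξ) ∂(sigma n)) := by
    -- Off the diagonal `(p + i, q + i)` the pairing vanishes.
    refine ((injective_shift p q).hasSum_iff ?_).2 h1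
    rintro ⟨j, k⟩ hjk
    rw [spherePairing, gaussPairing, if_neg]
    · simp
    · rintro ⟨ha, hb⟩
      refine hjk ⟨j - p, ?_⟩
      simp only [Prod.mk.injEq]
      omega
  exact h5.unique ((hasSum_expansionCoeff hn η hs p q).mul_right _)

lemma integral_zonalTerm_mul_conj {n : ℕ} (hn : 2 ≤ n) (η : Sph n) (c : ℂ) {p q : ℕ}
    {h : Sph n → ℂ} (hh : h ∈ surfaceHarmonics n p q) :
    ∫ ξ, zonalTerm η c p q ξ * conj (h ξ) ∂(sigma n) = c * conj (h η) := by
  have h1 := congrArg conj (integral_mul_conj_zonalHarmonic (by omega) hh η)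
  rw [← integral_conj, map_mul, zonalNormSq_eq_inv hn, Complex.conj_ofReal,
    ← zonalNormSq_eq_inv hn] at h1
  simp only [zonalTerm, mul_assoc]
  rw [integral_const_mul, integral_const_mul]
  have h2 : ∫ ξ, zonalHarmonic η p q ξ * conj (h ξ) ∂(sigma n) =
      zonalNormSq n p q * conj (h η) := by
    rw [← h1]
    congr 1
    funext ξ
    simp [mul_comm]
  rw [h2, ← mul_assoc (dimH n p q : ℂ), mul_comm (dimH n p q : ℂ), zonalNormSq_mul_dimH hn,
    one_mul]

lemma zonalTerm_mem {n : ℕ} (hn : 2 ≤ n) (η : Sph n) (c : ℂ) (p q : ℕ) :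
    zonalTerm η c p q ∈ surfaceHarmonics n p q :=
  Submodule.smul_mem _ (c * (dimH n p q : ℂ)) (zonalHarmonic_mem hn η p q)

end

end ComplexSphere

end

/-- The expansion theorem for zonal functions on the unit sphere of `ℂⁿ`. -/
theorem mainTheorem1 (n : ℕ) (hn : 2 ≤ n) (η : ComplexSphere.Sph n)
    (f : ComplexSphere.Sph n → ℂ) (φ : ℂ → ℂ)
    (hzonal : ComplexSphere.IsZonal η f)
    (hprofile : ComplexSphere.IsProfile η f φ)
    (hcont : ContinuousOn φ (Metric.closedBall (0 : ℂ) 1))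
    (hanalytic : AnalyticOnNhd ℝ φ (Metric.ball (0 : ℂ) 1))
    (habs : ∀ w : ℂ, ‖w‖ = 1 → Summable fun jk : ℕ × ℕ =>
      ‖ComplexSphere.taylorDeriv φ jk.1 jk.2 / ((jk.1.factorial : ℂ) * (jk.2.factorial : ℂ)) *
        w ^ jk.1 * (starRingEnd ℂ w) ^ jk.2‖) :
    -- the series defining the coefficients converge absolutely
    (∀ p q : ℕ, Summable fun k : ℕ => ‖ComplexSphere.coeffTerm n φ p q k‖) ∧
    -- they give the coefficients of the spherical harmonic expansion of `f`
    (∀ (p q : ℕ) (c : ℂ),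
      ComplexSphere.IsHarmonicComponent n p q f (ComplexSphere.zonalTerm η c p q) ↔
        c = ComplexSphere.expansionCoeff n φ p q) ∧
    -- the expansion converges absolutely on the sphere
    (∀ ξ : ComplexSphere.Sph n, Summable fun pq : ℕ × ℕ =>
      ‖ComplexSphere.zonalTerm η (ComplexSphere.expansionCoeff n φ pq.1 pq.2) pq.1 pq.2 ξ‖) ∧
    -- and uniformly, to `f`
    TendstoUniformly
      (fun (s : Finset (ℕ × ℕ)) (ξ : ComplexSphere.Sph n) => ∑ pq ∈ s,
        ComplexSphere.zonalTerm η (ComplexSphere.expansionCoeff n φ pq.1 pq.2) pq.1 pq.2 ξ)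
      f Filter.atTop := by
  open ComplexSphere MeasureTheory in
  have hn0 : 0 < n := by omega
  -- On the unit circle the norms of the terms do not depend on `w`, so `w = 1` suffices.
  have hs : Summable fun jk => ‖taylorCoeff φ jk‖ := by
    simpa [taylorCoeff] using habs 1 (by simp)
  have hf : ∀ ξ, HasSum (fun jk : ℕ × ℕ => taylorCoeff φ jk * zonalMonomial η jk.1 jk.2 ξ)
      (f ξ) := fun ξ => by
    rw [hprofile ξ]
    exact hasSum_taylorCoeff hcont hanalytic hs (norm_herm_le ξ η)
  have hfc : Continuous f := by
    rw [funext hprofile]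
    exact hcont.comp_continuous (continuous_herm η) fun ξ => by simpa using norm_herm_le ξ η
  have hfib := fun ξ => hasSum_tripleTerm_fiber hn η hs ξ
  have hsum : ∀ ξ, HasSum (fun pq : ℕ × ℕ =>
      zonalTerm η (expansionCoeff n φ pq.1 pq.2) pq.1 pq.2 ξ) (f ξ) := fun ξ =>
    (hasSum_tripleTerm hn η hs ξ (hf ξ)).prod_fiberwise (hfib ξ)
  have hmaj := summable_majorant hn η hs
  have hbound : ∀ (pq : ℕ × ℕ) (ξ : Sph n),
      ‖zonalTerm η (expansionCoeff n φ pq.1 pq.2) pq.1 pq.2 ξ‖ ≤ ∑' i, majorant n φ (pq, i) := by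
    intro pq ξ
    rw [← (hfib ξ pq).tsum_eq]
    exact tsum_of_norm_bounded (hmaj.prod_factor pq).hasSum
      fun i => norm_tripleTerm_le hn η φ ξ (pq, i)
  have hmaj' : Summable fun pq : ℕ × ℕ => ∑' i, majorant n φ (pq, i) := hmaj.prod
  refine ⟨summable_norm_coeffTerm hn η hs, fun p q c => ?_, fun ξ => ?_, ?_⟩
  · have hdiff : ∀ h ∈ surfaceHarmonics n p q,
        ∫ ξ, (f ξ - zonalTerm η c p q ξ) * (starRingEnd ℂ) (h ξ) ∂(sigma n) =
          (expansionCoeff n φ p q - c) * (starRingEnd ℂ) (h η) := by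
      intro h hh
      have hc := continuous_of_mem hh
      have hZ := continuous_of_mem (zonalTerm_mem hn η c p q)
      simp_rw [sub_mul]
      rw [integral_sub (integrable_of_continuous hn0 (by fun_prop))
        (integrable_of_continuous hn0 (by fun_prop)), integral_mul_conj_of_hasSum hn η hs hf hh,
        integral_zonalTerm_mul_conj hn η c hh]
    constructor
    · rintro ⟨-, -, horth⟩
      -- Testing against the zonal harmonic, which is `1` at the pole, isolates `d_{p,q} - c`.
      have h1 := horth _ (zonalHarmonic_mem hn η p q)
      rw [hdiff _ (zonalHarmonic_mem hn η p q), zonalHarmonic_self, map_one, mul_one] at h1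
      exact (sub_eq_zero.1 h1).symm
    · rintro rfl
      have := isProbabilityMeasure_sigma hn0
      refine ⟨hfc.memLp_of_hasCompactSupport (HasCompactSupport.of_compactSpace f),
        zonalTerm_mem hn η _ p q, fun h hh => ?_⟩
      rw [hdiff h hh, sub_self, zero_mul]
  · exact Summable.of_nonneg_of_le (fun _ => norm_nonneg _) (fun pq => hbound pq ξ) hmaj'
  · have h1 := tendstoUniformly_tsum hmaj' hbound
    rwa [funext fun ξ => (hsum ξ).tsum_eq] at h1
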